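/- Let $T$ be a locally compact, separable, metrizable, $0$-dimensional space and let $\Gamma$ be a pseudogroup of homeomorphisms between open subsets of $T$, with orbit equivalence relation $\mathcal R=\{(y,\gamma(y)) : \gamma\in\Gamma,\ y\in\mathrm{dom}\,\gamma\}$. Assume that $\Gamma$ acts freely, i.e. an element of $\Gamma$ fixing a point coincides with the identity near this point, and endow $\mathcal R$ with the topology generated by the graphs of the elements of $\Gamma$. Assume that $\Gamma$ is compactly generated: there is a relatively compact open set $T_1\subset T$ meeting all the orbits, such that the reduction $\Gamma|_{T_1}$ (the elements with domain and range in $T_1$) has a finite generating set each element of which is the restriction of an element of $\Gamma$ whose domain contains the closure of its own domain. Let $\Gamma^{(1)}$ be a finite generating set of $\Gamma$. It defines a graph with vertex set $T$: write $z\sim w$ if $z\neq w$ and some element of $\Gamma^{(1)}$ sends $z$ to $w$ or $w$ to $z$, and let $\deg(z)$ be the number of neighbours of $z$. Assume that $\Gamma^{(1)}$ is recurrent, i.e. every point of $T$ is at uniformly bounded graph distance from $T_1$. Let $\delta:\mathcal R\to\mathbb R^*_+$ be a continuous harmonic cocycle, i.e. $\delta$ is continuous, $\delta(x,y)\delta(y,z)=\delta(x,z)$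 for $(x,y),(y,z)\in\mathcal R$, every point has at least one neighbour, and $\delta(z,y)=\frac1{\deg(z)}\sum_{w\sim z}\delta(w,y)$ for all $(z,y)\in\mathcal R$. For a finite subset $B$ of the orbit $\mathcal R[y]$ put $|B|_y=\sum_{z\in B}\delta(z,y)$. Let $\{A_n\}$ be a $\delta$-averaging sequence, i.e. a sequence of nonempty finite sets $A_n\subset\mathcal R[y_n]$ with $$\lim_{n\to\infty}\frac{|\Delta_\gamma A_n|_{y_n}}{|A_n|_{y_n}}=0\quad\text{for all }\gamma\in\Gamma^{(1)},$$ where $\Delta_\gamma A=\{x\in \mathrm{dom}\,\gamma : \text{exactly one of } x,\gamma(x) \text{ belongs to } A\}$. Its limit set is the set of all limits of sequences $u_k\in A_{n_k}$ with $n_1<n_2<\cdots$. Then there is a nonzero finite regular Borel measure $\nu$ on $T$ whose support is contained in the limit set of $\{A_n\}$ and which is harmonic: it is quasi-invariant under $\Gamma$, and for every bounded measurable $f:T\to\mathbb R$ the function $\Delta f(y)=\frac1{\deg(y)}\sum_{z\sim y}f(z)-f(y)$ is $\nu$-integrable with $\int\Delta f\,d\nu=0$. Moreover $\nu$ arises from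 $\{A_n\}$ as $\nu=\deg\cdot\nu_0$, where $\nu_0$ is a finite measure with Radon–Nikodym cocycle $\delta$, i.e. $\nu_0(\gamma(B))=\int_B\delta(\gamma(y),y)\,d\nu_0(y)$ for all $\gamma\in\Gamma$ and all Borel sets $B\subset\mathrm{dom}\,\gamma$, and $\nu_0$ is the vague limit of a subsequence of the probability measures $\nu_n(B)=|B\cap A_n|_{y_n}/|A_n|_{y_n}$. -/

import Mathlib

open MeasureTheory Filter
open scoped Topology

noncomputable section

namespace Averaging

variable {T : Type*} [TopologicalSpace T]

/-! ### Pseudogroups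

A pseudogroup of homeomorphisms between open subsets of `T` is a `StructureGroupoid T` which is
closed under restriction to open subsets. -/

/-- `S` generates `Γ`: `Γ` is the smallest pseudogroup containing `S`. -/
def Generates (Γ : StructureGroupoid T) (S : Set (OpenPartialHomeomorph T T)) : Prop :=
  (∀ γ ∈ S, γ ∈ Γ) ∧
    ∀ G : StructureGroupoid T, ClosedUnderRestriction G → (∀ γ ∈ S, γ ∈ G) → Γ ≤ G

/-- The orbit equivalence relation of `Γ`: the pairs `(y, γ y)` with `γ ∈ Γ` defined at `y`. -/
def orbitRel (Γ : StructureGroupoid T) : Set (T × T) :=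
  {p | ∃ γ ∈ Γ, p.1 ∈ γ.source ∧ γ p.1 = p.2}

/-- The topology of the orbit equivalence relation generated by the graphs of the elements
of `Γ`. -/
abbrev etaleTopology (Γ : StructureGroupoid T) : TopologicalSpace (orbitRel Γ) :=
  TopologicalSpace.generateFrom
    {U | ∃ γ ∈ Γ, U = {p : orbitRel Γ | p.1.1 ∈ γ.source ∧ γ p.1.1 = p.1.2}}

/-- `Γ` acts freely: an element of `Γ` fixing a point has the germ of the identity there. -/
def ActsFreely (Γ : StructureGroupoid T) : Prop :=
  ∀ γ ∈ Γ, ∀ x ∈ γ.source, γ x = x → ∀ᶠ z in 𝓝 x, γ z = z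

/-- The finite set `E` is a compact generation system of `Γ` on `T₁`: the set `T₁` is open,
relatively compact and meets every orbit, `E` generates the reduction of `Γ` to `T₁`, and every
element of `E` is the restriction of an element of `Γ` whose domain contains the closure of its
own domain. (An element with domain and range in `T₁` lies in the pseudogroup on `T₁` generated
by `E` if and only if it lies in the pseudogroup on `T` generated by `E`.) -/
structure IsCompactGenerationSystem (Γ : StructureGroupoid T) (T₁ : Set T)
    (E : Set (OpenPartialHomeomorph T T)) : Prop where
  isOpen : IsOpen T₁
  isCompact_closure : IsCompact (closure T₁)
  meets_orbits : ∀ y : T, ∃ z ∈ T₁, (y, z) ∈ orbitRel Γ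
  finite : E.Finite
  mem_reduction : ∀ γ ∈ E, γ ∈ Γ ∧ γ.source ⊆ T₁ ∧ γ.target ⊆ T₁
  generates : ∀ G : StructureGroupoid T, ClosedUnderRestriction G → (∀ γ ∈ E, γ ∈ G) →
    ∀ γ ∈ Γ, γ.source ⊆ T₁ → γ.target ⊆ T₁ → γ ∈ G
  extends_to_closure : ∀ γ ∈ E, ∃ γ' ∈ Γ, closure γ.source ⊆ γ'.source ∧ Set.EqOn γ γ' γ.source

/-- The graph whose vertices are the points of `T`, two distinct points `z`, `w` being joined by
an edge if an element of `S` sends one to the other. If `S` generates a pseudogroup, then its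
connected components are the orbits. -/
def orbitGraph (S : Set (OpenPartialHomeomorph T T)) : SimpleGraph T :=
  SimpleGraph.fromRel fun z w => ∃ γ ∈ S, z ∈ γ.source ∧ γ z = w

/-- The finite generating set `S` is recurrent with respect to `T₁`: every point of `T` is at
uniformly bounded graph distance from a point of `T₁` (in its orbit). -/
def IsRecurrent (S : Set (OpenPartialHomeomorph T T)) (T₁ : Set T) : Prop :=
  ∃ N : ℕ, ∀ y : T, ∃ z ∈ T₁, ∃ p : (orbitGraph S).Walk y z, p.length ≤ N

/-- The number of neighbours of `y`. -/
def deg (S : Set (OpenPartialHomeomorph T T)) (y : T) : ℕ :=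
  ((orbitGraph S).neighborSet y).ncard

/-- The Laplace operator of the simple random walk:
`Δ f (y) = (1 / deg y) ∑_{z ∼ y} f z - f y`. -/
def laplacian (S : Set (OpenPartialHomeomorph T T)) (f : T → ℝ) (y : T) : ℝ :=
  (1 / (deg S y : ℝ)) * (∑ᶠ z ∈ (orbitGraph S).neighborSet y, f z) - f y

/-! ### Cocycles

A function on the orbit equivalence relation is given by a function of two variables, of which
only the values on the relation are ever used. -/

/-- `δ` is a cocycle on the orbit equivalence relation with positive real values. -/
def IsCocycle (Γ : StructureGroupoid T) (δ : T → T → ℝ) : Prop :=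
  (∀ x y, (x, y) ∈ orbitRel Γ → 0 < δ x y) ∧
    ∀ x y z, (x, y) ∈ orbitRel Γ → (y, z) ∈ orbitRel Γ → δ x y * δ y z = δ x z

/-- `δ` is continuous on the orbit equivalence relation. -/
def IsContinuousCocycle (Γ : StructureGroupoid T) (δ : T → T → ℝ) : Prop :=
  @Continuous (orbitRel Γ) ℝ (etaleTopology Γ) _ fun p => δ p.1.1 p.1.2

/-- `δ` is harmonic: `δ (z, y) = (1 / deg z) ∑_{w ∼ z} δ (w, y)` for all `y` and all `z` in the
orbit of `y`. (For a positive `δ` this includes that every vertex has a neighbour.) -/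
def IsHarmonicCocycle (Γ : StructureGroupoid T) (S : Set (OpenPartialHomeomorph T T))
    (δ : T → T → ℝ) : Prop :=
  ∀ y z, (y, z) ∈ orbitRel Γ →
    δ z y = (1 / (deg S z : ℝ)) * ∑ᶠ w ∈ (orbitGraph S).neighborSet z, δ w y

/-! ### Averaging sequences -/

/-- The weight `|B|_y = ∑_{z ∈ B} δ (z, y)` of a finite subset `B` of the orbit of `y`. -/
def weight (δ : T → T → ℝ) (y : T) (B : Set T) : ℝ := ∑ᶠ z ∈ B, δ z y

/-- The difference set: the points `x ∈ A` with `γ x ∉ A` and the points `x ∉ A` with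
`γ x ∈ A`, where `γ x ∉ A` is understood to hold if `γ x` is not defined. -/
def differenceSet (γ : OpenPartialHomeomorph T T) (A : Set T) : Set T :=
  {x | x ∈ A ∧ ¬ (x ∈ γ.source ∧ γ x ∈ A)} ∪ {x | x ∉ A ∧ x ∈ γ.source ∧ γ x ∈ A}

/-- The nonempty finite sets `A n`, contained in the orbits of the points `y n`, form a
`δ`-averaging sequence. Only the points of the difference sets at which `γ` is defined are
counted; a sequence for which the weights of the full difference sets are negligible is a
fortiori averaging in this sense. -/
structure IsAveragingSequence (Γ : StructureGroupoid T) (S : Set (OpenPartialHomeomorph T T))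
    (δ : T → T → ℝ) (y : ℕ → T) (A : ℕ → Finset T) : Prop where
  nonempty : ∀ n, (A n).Nonempty
  subset_orbit : ∀ n, ∀ z ∈ A n, (y n, z) ∈ orbitRel Γ
  tendsto : ∀ γ ∈ S, Tendsto
    (fun n => weight δ (y n) (differenceSet γ (A n) ∩ γ.source) / weight δ (y n) (A n))
    atTop (𝓝 0)

/-- The limit set of a sequence of sets: the limits of the convergent sequences of points
`u k ∈ A (φ k)` along subsequences. -/
def limitSet (A : ℕ → Finset T) : Set T :=
  {x | ∃ (φ : ℕ → ℕ) (u : ℕ → T), StrictMono φ ∧ (∀ k, u k ∈ A (φ k)) ∧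
    Tendsto u atTop (𝓝 x)}

/-! ### Measures -/

variable [MeasurableSpace T]

/-- `ν` is quasi-invariant: the elements of `Γ` preserve the null sets. -/
def IsQuasiInvariant (Γ : StructureGroupoid T) (ν : Measure T) : Prop :=
  ∀ γ ∈ Γ, ∀ B : Set T, MeasurableSet B → B ⊆ γ.source → (ν (γ '' B) = 0 ↔ ν B = 0)

/-- `ν` has Radon-Nikodym cocycle `δ`, that is `dν (z) = δ (z, y) dν (y)` for `z = γ y`. -/
def HasRadonNikodymCocycle (Γ : StructureGroupoid T) (δ : T → T → ℝ) (ν : Measure T) : Prop :=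
  ∀ γ ∈ Γ, ∀ B : Set T, MeasurableSet B → B ⊆ γ.source →
    ν (γ '' B) = ∫⁻ y in B, ENNReal.ofReal (δ (γ y) y) ∂ν

/-- `ν` is a harmonic measure for the simple random walk: it is quasi-invariant and
`∫ Δ f dν = 0` for all bounded measurable `f`. -/
def IsHarmonicMeasure (Γ : StructureGroupoid T) (S : Set (OpenPartialHomeomorph T T))
    (ν : Measure T) : Prop :=
  IsQuasiInvariant Γ ν ∧
    ∀ f : T → ℝ, Measurable f → (∃ C : ℝ, ∀ x, |f x| ≤ C) →
      Integrable (laplacian S f) ν ∧ ∫ x, laplacian S f x ∂ν = 0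

/-- `ν₀` is the vague limit, along the subsequence `φ`, of the probability measures
`B ↦ |B ∩ A n|_{y n} / |A n|_{y n}`. -/
def IsVagueLimit (δ : T → T → ℝ) (y : ℕ → T) (A : ℕ → Finset T) (φ : ℕ → ℕ)
    (ν₀ : Measure T) : Prop :=
  ∀ f : T → ℝ, Continuous f → HasCompactSupport f →
    Tendsto
      (fun k => (∑ z ∈ A (φ k), f z * δ z (y (φ k))) / weight δ (y (φ k)) (A (φ k)))
      atTop (𝓝 (∫ x, f x ∂ν₀))

end Averaging

end

/-! ### Zero-dimensional locally compact spaces -/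

namespace Averaging

section CompactOpen

variable {X : Type*} [TopologicalSpace X]

/-! The normalized `δ`-weights on the sets `A n` are probability measures, and by compactness of the
one-point compactification a subsequence converges vaguely to a finite measure `ν₀`; mass may be
lost at infinity.

Covariance. By the cocycle identity, the weight of `A ∩ γ(K)` and the sum of `δ (γ x) x * δ x y`
over `A ∩ K` differ by at most `sup_K δ (γ x) x` times the weight of the difference set
(`abs_sum_image_sub_sum_le`). For compact open `K` the supremum is finite, and the functions
involved are continuous with compact support, so the averaging condition gives `ν₀(γ K) = ∫_K δ (γ
x) x dν₀`. In a zero-dimensional space such sets determine a measure, so `ν₀` transforms by `δ`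
along generators. The elements along which it does form a pseudogroup, hence all of `Γ`.

Nontriviality. Harmonicity bounds the total weight of the neighbours of a point by its degree times
its own weight. By recurrence, each point of `A` is within `N` steps of `A ∩ T₁` or of a difference
set, so `|A| ≤ (1 + m)^N (|A ∩ T₁| + ∑ |Δ_γ A|)` (`EnumeratesEdges.weight_le`). A definite
proportion of the mass therefore stays in a compact set.

Harmonicity. Transporting mass along edges turns `∫ ∑_{w ∼ x} f w dν₀` into `∫ (∑_{w ∼ x} δ w x) f x
dν₀`, and the inner sum is `deg x` because `δ` is harmonic. Weighting by `deg` cancels the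
denominator of the Laplacian. -/

lemma exists_compactOpen_nhds [LocallyCompactSpace X]
    (hzero : TopologicalSpace.IsTopologicalBasis {U : Set X | IsClopen U})
    {x : X} {U : Set X} (hU : U ∈ 𝓝 x) : ∃ K, IsCompact K ∧ IsClopen K ∧ x ∈ K ∧ K ⊆ U := by
  obtain ⟨C, hC, hCU, hCc⟩ := local_compact_nhds hU
  obtain ⟨V, hV, hxV, hVC⟩ := hzero.mem_nhds_iff.1 hC
  exact ⟨V, hCc.of_isClosed_subset hV.1 hVC, hV, hxV, hVC.trans hCU⟩

lemma exists_compactOpen_superset [LocallyCompactSpace X]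
    (hzero : TopologicalSpace.IsTopologicalBasis {U : Set X | IsClopen U})
    {C : Set X} (hC : IsCompact C) : ∃ K, IsCompact K ∧ IsClopen K ∧ C ⊆ K := by
  choose K hKc hKo hxK _ using fun x : X => exists_compactOpen_nhds hzero (univ_mem : _ ∈ 𝓝 x)
  obtain ⟨t, -, ht⟩ := hC.elim_nhds_subcover K fun x _ => (hKo x).2.mem_nhds (hxK x)
  exact ⟨⋃ x ∈ t, K x, t.finite_toSet.isCompact_biUnion fun x _ => hKc x,
    t.finite_toSet.isClopen_biUnion fun x _ => hKo x, ht⟩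

lemma exists_seq_compactOpen_iUnion_eq [LocallyCompactSpace X] [SecondCountableTopology X]
    (hzero : TopologicalSpace.IsTopologicalBasis {U : Set X | IsClopen U})
    {U : Set X} (hU : IsOpen U) :
    ∃ K : ℕ → Set X, Monotone K ∧ (∀ n, IsCompact (K n) ∧ IsClopen (K n)) ∧ ⋃ n, K n = U := by
  choose! C hCc hCo hxC hCU using
    fun (x : X) (hx : x ∈ U) => exists_compactOpen_nhds hzero (hU.mem_nhds hx)
  obtain ⟨t, htU, htc, ht⟩ := TopologicalSpace.countable_cover_nhdsWithin
    (f := C) (s := U) fun x hx => mem_nhdsWithin_of_mem_nhds ((hCo x hx).2.mem_nhds (hxC x hx))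
  rcases t.eq_empty_or_nonempty with rfl | hne
  · refine ⟨fun _ => ∅, monotone_const, fun _ => ⟨isCompact_empty, isClopen_empty⟩, ?_⟩
    simpa [Set.subset_empty_iff, eq_comm] using ht
  · obtain ⟨a, rfl⟩ := htc.exists_eq_range hne
    have ha : ∀ n, a n ∈ U := fun n => htU ⟨n, rfl⟩
    refine ⟨Set.accumulate fun n => C (a n), Set.monotone_accumulate, fun n => ⟨?_, ?_⟩, ?_⟩
    · exact (Set.finite_Iic n).isCompact_biUnion fun k _ => hCc _ (ha k)
    · exact (Set.finite_Iic n).isClopen_biUnion fun k _ => hCo _ (ha k)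
    · rw [Set.iUnion_accumulate]
      refine (Set.iUnion_subset fun n => hCU _ (ha n)).antisymm ?_
      simpa using ht

/-- A finite measure is determined by its values on compact open sets. -/
lemma measure_eq_of_compactOpen [LocallyCompactSpace X] [SecondCountableTopology X]
    [MeasurableSpace X] [BorelSpace X]
    (hzero : TopologicalSpace.IsTopologicalBasis {U : Set X | IsClopen U})
    {W : Set X} (hW : IsOpen W) {μ₁ μ₂ : Measure X} [IsFiniteMeasure μ₁]
    (h₁ : μ₁ Wᶜ = 0) (h₂ : μ₂ Wᶜ = 0)
    (h : ∀ K ⊆ W, IsCompact K → IsClopen K → μ₁ K = μ₂ K) : μ₁ = μ₂ := by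
  have hopen : ∀ U, IsOpen U → μ₁ U = μ₂ U := by
    intro U hU
    have key : ∀ μ : Measure X, μ Wᶜ = 0 → μ U = μ (U ∩ W) := by
      intro μ hμ
      refine (measure_inter_conull' ?_).symm
      exact measure_mono_null (fun x hx => hx.2) hμ
    -- Continuity from below passes from compact open sets to open sets, which form a π-system
    -- generating the Borel sets.
    obtain ⟨K, hmono, hK, hKU⟩ := exists_seq_compactOpen_iUnion_eq hzero (hU.inter hW)
    rw [key _ h₁, key _ h₂, ← hKU, hmono.measure_iUnion, hmono.measure_iUnion]
    refine iSup_congr fun n => h _ ?_ (hK n).1 (hK n).2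
    exact ((Set.subset_iUnion K n).trans hKU.subset).trans Set.inter_subset_right
  refine ext_of_generate_finite {U | IsOpen U} ?_ isPiSystem_isOpen hopen (hopen _ isOpen_univ)
  exact BorelSpace.measurable_eq

end CompactOpen

/-! ### Sequential compactness in the vague topology -/

section Vague

variable {X : Type*} [TopologicalSpace X]

/-- Every compact set lies in some member of a compact exhaustion, so the complements of its members
form a countable neighbourhood basis at infinity. Second countability is what allows extraction of
subsequences, rather than subnets, of probability measures on the compactification. -/
lemma secondCountableTopology_onePoint [T2Space X] [LocallyCompactSpace X]
    [SecondCountableTopology X] : SecondCountableTopology (OnePoint X) := by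
  let b := TopologicalSpace.countableBasis X
  let K := CompactExhaustion.choice X
  let B : Set (Set (OnePoint X)) := ((fun s : Set X => (OnePoint.some '' s)) '' b) ∪
    Set.range fun n => (OnePoint.some '' K n)ᶜ
  have hB : TopologicalSpace.IsTopologicalBasis B := by
    refine TopologicalSpace.isTopologicalBasis_of_isOpen_of_nhds ?_ ?_
    · rintro u (⟨s, hs, rfl⟩ | ⟨n, rfl⟩)
      · exact OnePoint.isOpen_image_coe.2 (TopologicalSpace.isOpen_of_mem_countableBasis hs)
      · exact OnePoint.isOpen_compl_image_coe.2 ⟨(K.isCompact n).isClosed, K.isCompact n⟩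
    · intro a u ha hu
      induction a using OnePoint.rec with
      | infty =>
        have hc := ((OnePoint.isOpen_iff_of_mem ha).1 hu).2
        obtain ⟨n, hn⟩ := K.exists_superset_of_isCompact hc
        refine ⟨_, Or.inr ⟨n, rfl⟩, by simp, ?_⟩
        intro z hz
        induction z using OnePoint.rec with
        | infty => exact ha
        | coe z =>
          by_contra hzu
          exact hz ⟨z, hn hzu, rfl⟩
      | coe a =>
        have ho : IsOpen (OnePoint.some ⁻¹' u : Set X) := hu.preimage OnePoint.continuous_coe
        obtain ⟨v, hv, hav, hvu⟩ :=
          (TopologicalSpace.isBasis_countableBasis X).exists_subset_of_mem_open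
            (show a ∈ OnePoint.some ⁻¹' u from ha) ho
        exact ⟨_, Or.inl ⟨v, hv, rfl⟩, ⟨a, hav, rfl⟩, Set.image_subset_iff.2 hvu⟩
  exact hB.secondCountableTopology
    (((TopologicalSpace.countable_countableBasis X).image _).union (Set.countable_range _))

/-- A sequence of probability measures on a second countable locally compact Hausdorff space has
a vaguely convergent subsequence. -/
lemma exists_subseq_tendsto_vague [T2Space X] [LocallyCompactSpace X]
    [SecondCountableTopology X] [MeasurableSpace X] [BorelSpace X]
    (μ : ℕ → Measure X) (hμ : ∀ n, IsProbabilityMeasure (μ n)) :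
    ∃ (φ : ℕ → ℕ) (ν : Measure X), StrictMono φ ∧ IsFiniteMeasure ν ∧
      ∀ f : X → ℝ, Continuous f → HasCompactSupport f →
        Tendsto (fun k => ∫ x, f x ∂μ (φ k)) atTop (𝓝 (∫ x, f x ∂ν)) := by
  have := secondCountableTopology_onePoint (X := X)
  let : MeasurableSpace (OnePoint X) := borel _
  have : BorelSpace (OnePoint X) := ⟨rfl⟩
  have hemb : MeasurableEmbedding (OnePoint.some : X → OnePoint X) :=
    OnePoint.isOpenEmbedding_coe.measurableEmbedding
  let P : ℕ → ProbabilityMeasure (OnePoint X) := fun n =>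
    ⟨(μ n).map OnePoint.some, Measure.isProbabilityMeasure_map hemb.measurable.aemeasurable⟩
  obtain ⟨ρ, φ, hφ, hlim⟩ := CompactSpace.tendsto_subseq P
  -- Pulling back discards the mass at infinity. The integrals of compactly supported functions are
  -- unaffected, since their extensions vanish there.
  refine ⟨φ, (ρ : Measure (OnePoint X)).comap OnePoint.some, hφ, ?_, ?_⟩
  · refine ⟨?_⟩
    rw [hemb.comap_apply]
    exact measure_lt_top _ _
  · intro f hf hfc
    have h0 : Tendsto f (coclosedCompact X) (𝓝 0) := by
      rw [coclosedCompact_eq_cocompact]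
      exact hfc.is_zero_at_infty
    let F : C(OnePoint X, ℝ) := OnePoint.continuousMapMk ⟨f, hf⟩ 0 h0
    have hFs : ∀ x : X, F x = f x := fun x => rfl
    have hFi : F OnePoint.infty = 0 := rfl
    have h := (ProbabilityMeasure.tendsto_iff_forall_integral_tendsto.1 hlim)
      (BoundedContinuousFunction.mkOfCompact F)
    have e1 : ∀ k, ∫ ω, F ω ∂((P ∘ φ) k : Measure (OnePoint X)) = ∫ x, f x ∂μ (φ k) := by
      intro k
      exact hemb.integral_map F
    have e2 : ∫ ω, F ω ∂(ρ : Measure (OnePoint X)) =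
        ∫ x, f x ∂((ρ : Measure (OnePoint X)).comap OnePoint.some) := by
      refine Eq.trans ?_ (hemb.integral_map F)
      rw [hemb.map_comap]
      refine (setIntegral_eq_integral_of_forall_compl_eq_zero fun z hz => ?_).symm
      induction z using OnePoint.rec with
      | infty => exact hFi
      | coe z => exact absurd ⟨z, rfl⟩ hz
    simp only [BoundedContinuousFunction.mkOfCompact_apply, e1, e2] at h
    exact h

end Vague

end Averaging

namespace Averaging

/-! ### Orbits and continuity of the cocycle -/

section Orbit

variable {T : Type*} [TopologicalSpace T] {Γ : StructureGroupoid T}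
  {γ : OpenPartialHomeomorph T T} {x y z : T} {δ : T → T → ℝ}

lemma orbitRel_apply (hγ : γ ∈ Γ) (hx : x ∈ γ.source) : (x, γ x) ∈ orbitRel Γ :=
  ⟨γ, hγ, hx, rfl⟩

lemma orbitRel_refl (x : T) : (x, x) ∈ orbitRel Γ :=
  ⟨_, Γ.id_mem, trivial, rfl⟩

lemma orbitRel_symm (h : (x, y) ∈ orbitRel Γ) : (y, x) ∈ orbitRel Γ := by
  obtain ⟨γ, hγ, hx, hxy⟩ := h
  dsimp only at hx hxy
  subst hxy
  exact ⟨γ.symm, Γ.symm hγ, γ.map_source hx, γ.left_inv hx⟩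

lemma orbitRel_trans (h : (x, y) ∈ orbitRel Γ) (h' : (y, z) ∈ orbitRel Γ) :
    (x, z) ∈ orbitRel Γ := by
  obtain ⟨γ, hγ, hx, hxy⟩ := h
  obtain ⟨η, hη, hy, hyz⟩ := h'
  dsimp only at hx hxy hy hyz
  subst hxy hyz
  refine ⟨γ.trans η, Γ.trans hγ hη, ?_, rfl⟩
  rw [OpenPartialHomeomorph.trans_source]
  exact ⟨hx, hy⟩

lemma IsCocycle.self_eq_one (hδ : IsCocycle Γ δ) (x : T) : δ x x = 1 := by
  have h := hδ.2 x x x (orbitRel_refl x) (orbitRel_refl x)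
  have h0 := hδ.1 x x (orbitRel_refl x)
  nlinarith

/-- The cocycle along an element of the pseudogroup is a continuous function on its domain. -/
lemma continuousOn_cocycle_apply (hfree : ActsFreely Γ) (hδcont : IsContinuousCocycle Γ δ)
    (hγ : γ ∈ Γ) : ContinuousOn (fun x => δ (γ x) x) γ.source := by
  rw [continuousOn_iff_continuous_domRestrict]
  let := etaleTopology Γ
  let g : γ.source → orbitRel Γ := fun x => ⟨(γ x, x), orbitRel_symm (orbitRel_apply hγ x.2)⟩
  have hg : Continuous g := by
    refine continuous_generateFrom_iff.2 ?_
    rintro _ ⟨η, hη, rfl⟩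
    rw [isOpen_iff_mem_nhds]
    rintro ⟨x, hx⟩ ⟨h1, h2⟩
    have hmem : x ∈ (γ.trans η).source := by
      rw [OpenPartialHomeomorph.trans_source]
      exact ⟨hx, h1⟩
    -- If `η` sends `γ x` back to `x`, freeness makes `η ∘ γ` the identity near `x`, so nearby pairs
    -- `(γ z, z)` stay in the graph of `η`.
    have h3 := hfree _ (Γ.trans hγ hη) x hmem h2
    have h4 : ∀ᶠ z in 𝓝 x, z ∈ (γ.trans η).source := (γ.trans η).open_source.mem_nhds hmem
    have h5 : Tendsto (Subtype.val : γ.source → T) (𝓝 ⟨x, hx⟩) (𝓝 x) := continuousAt_subtype_val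
    filter_upwards [h5.eventually (h3.and h4)] with z hz
    obtain ⟨hz1, hz2⟩ := hz
    rw [OpenPartialHomeomorph.trans_source] at hz2
    exact ⟨hz2.2, hz1⟩
  exact hδcont.comp hg

end Orbit

/-! ### The Radon-Nikodym cocycle -/

section RadonNikodym

variable {T : Type*} [TopologicalSpace T] [MeasurableSpace T] [BorelSpace T]
  {Γ : StructureGroupoid T} {γ η : OpenPartialHomeomorph T T} {δ : T → T → ℝ} {ν : Measure T}
  {B : Set T}

lemma measurableSet_source_inter_preimage (γ : OpenPartialHomeomorph T T) (hB : MeasurableSet B) :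
    MeasurableSet (γ.source ∩ γ ⁻¹' B) := by
  have h : Measurable (γ.source.domRestrict γ) :=
    (continuousOn_iff_continuous_domRestrict.1 γ.continuousOn).measurable
  have := γ.open_source.measurableSet.subtype_image (h hB)
  rwa [Set.domRestrict_eq, Set.preimage_comp, Subtype.image_preimage_coe] at this

lemma measurableSet_image (γ : OpenPartialHomeomorph T T) (hB : MeasurableSet B)
    (hBs : B ⊆ γ.source) : MeasurableSet (γ '' B) := by
  rw [γ.image_eq_target_inter_inv_preimage hBs]
  exact measurableSet_source_inter_preimage γ.symm hB

lemma aemeasurable_of_subset_source (γ : OpenPartialHomeomorph T T) (hB : MeasurableSet B)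
    (hBs : B ⊆ γ.source) : AEMeasurable γ (ν.restrict B) :=
  (γ.continuousOn.mono hBs).aemeasurable hB

/-- The density of the image of `ν` under the single partial homeomorphism `γ` is given
by `δ`. -/
def HasDensityAlong (δ : T → T → ℝ) (ν : Measure T) (γ : OpenPartialHomeomorph T T) : Prop :=
  ∀ B : Set T, MeasurableSet B → B ⊆ γ.source →
    ν (γ '' B) = ∫⁻ y in B, ENNReal.ofReal (δ (γ y) y) ∂ν

/-- As an equality of measures, the density property yields the change of variables formulas for
both kinds of integral. -/
lemma HasDensityAlong.map_withDensity [SFinite ν] (h : HasDensityAlong δ ν γ)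
    (hB : MeasurableSet B) (hBs : B ⊆ γ.source) :
    ((ν.restrict B).withDensity fun y => ENNReal.ofReal (δ (γ y) y)).map γ =
      ν.restrict (γ '' B) := by
  ext C hC
  rw [Measure.map_apply_of_aemeasurable _ hC, withDensity_apply', Measure.restrict_restrict' hB,
    ← h _ _ (Set.inter_subset_right.trans hBs), Measure.restrict_apply hC]
  · congr 1
    ext z
    constructor
    · rintro ⟨x, ⟨hx, hxB⟩, rfl⟩
      exact ⟨hx, x, hxB, rfl⟩
    · rintro ⟨hz, x, hxB, rfl⟩
      exact ⟨x, ⟨hz, hxB⟩, rfl⟩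
  · have : γ ⁻¹' C ∩ B = (γ.source ∩ γ ⁻¹' C) ∩ B := by
      ext x
      exact ⟨fun hx => ⟨⟨hBs hx.2, hx.1⟩, hx.2⟩, fun hx => ⟨hx.1.2, hx.2⟩⟩
    rw [this]
    exact (measurableSet_source_inter_preimage γ hC).inter hB
  · exact (aemeasurable_of_subset_source γ hB hBs).mono_ac (withDensity_absolutelyContinuous _ _)

lemma aemeasurable_ofReal_cocycle (hfree : ActsFreely Γ) (hδcont : IsContinuousCocycle Γ δ)
    (hγ : γ ∈ Γ) (hB : MeasurableSet B) (hBs : B ⊆ γ.source) :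
    AEMeasurable (fun y => ENNReal.ofReal (δ (γ y) y)) (ν.restrict B) :=
  (((continuousOn_cocycle_apply hfree hδcont hγ).mono hBs).aemeasurable hB).ennreal_ofReal

lemma HasDensityAlong.lintegral_image [SFinite ν] (h : HasDensityAlong δ ν γ)
    (hfree : ActsFreely Γ) (hδcont : IsContinuousCocycle Γ δ) (hγ : γ ∈ Γ)
    (hB : MeasurableSet B) (hBs : B ⊆ γ.source) {g : T → ENNReal}
    (hg : AEMeasurable g (ν.restrict (γ '' B))) :
    ∫⁻ z in γ '' B, g z ∂ν = ∫⁻ y in B, ENNReal.ofReal (δ (γ y) y) * g (γ y) ∂ν := by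
  have hm := h.map_withDensity hB hBs
  rw [← hm] at hg ⊢
  rw [lintegral_map' hg ((aemeasurable_of_subset_source γ hB hBs).mono_ac
    (withDensity_absolutelyContinuous _ _)),
    lintegral_withDensity_eq_lintegral_mul_non_measurable₀ _
      (aemeasurable_ofReal_cocycle hfree hδcont hγ hB hBs) (by simp)]
  rfl

lemma HasDensityAlong.integral_image [SFinite ν] (h : HasDensityAlong δ ν γ)
    (hδ : IsCocycle Γ δ)
    (hfree : ActsFreely Γ) (hδcont : IsContinuousCocycle Γ δ) (hγ : γ ∈ Γ)
    (hB : MeasurableSet B) (hBs : B ⊆ γ.source) {g : T → ℝ}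
    (hg : AEStronglyMeasurable g (ν.restrict (γ '' B))) :
    ∫ z in γ '' B, g z ∂ν = ∫ y in B, δ (γ y) y * g (γ y) ∂ν := by
  have hm := h.map_withDensity hB hBs
  rw [← hm] at hg ⊢
  rw [integral_map ((aemeasurable_of_subset_source γ hB hBs).mono_ac
    (withDensity_absolutelyContinuous _ _)) hg,
    integral_withDensity_eq_integral_toReal_smul₀
      (aemeasurable_ofReal_cocycle hfree hδcont hγ hB hBs) (by simp)]
  refine setIntegral_congr_fun hB fun y hy => ?_
  have hpos := hδ.1 _ _ (orbitRel_symm (orbitRel_apply hγ (hBs hy)))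
  simp only [smul_eq_mul, ENNReal.toReal_ofReal hpos.le]

/-- The chain rule for densities is the cocycle identity for the points `η (γ y)`, `γ y`, `y`. -/
lemma HasDensityAlong.trans [SFinite ν] (h : HasDensityAlong δ ν γ) (h' : HasDensityAlong δ ν η)
    (hδ : IsCocycle Γ δ) (hfree : ActsFreely Γ) (hδcont : IsContinuousCocycle Γ δ)
    (hγ : γ ∈ Γ) (hη : η ∈ Γ) : HasDensityAlong δ ν (γ.trans η) := by
  intro B hB hBs
  rw [OpenPartialHomeomorph.trans_source] at hBs
  have h1 : B ⊆ γ.source := fun x hx => (hBs hx).1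
  have h2 : γ '' B ⊆ η.source := by
    rintro _ ⟨x, hx, rfl⟩
    exact (hBs hx).2
  have hm := measurableSet_image γ hB h1
  rw [OpenPartialHomeomorph.coe_trans, Set.image_comp, h' _ hm h2,
    h.lintegral_image hfree hδcont hγ hB h1 (aemeasurable_ofReal_cocycle hfree hδcont hη hm h2)]
  refine setLIntegral_congr_fun hB fun y hy => ?_
  have r1 := orbitRel_apply hγ (h1 hy)
  have r2 := orbitRel_apply hη (h2 ⟨y, hy, rfl⟩)
  simp only [Function.comp_apply]
  rw [mul_comm, ← ENNReal.ofReal_mul (hδ.1 _ _ (orbitRel_symm r2)).le,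
    hδ.2 _ _ _ (orbitRel_symm r2) (orbitRel_symm r1)]

lemma HasDensityAlong.symm [SFinite ν] (h : HasDensityAlong δ ν γ)
    (hδ : IsCocycle Γ δ) (hfree : ActsFreely Γ) (hδcont : IsContinuousCocycle Γ δ)
    (hγ : γ ∈ Γ) : HasDensityAlong δ ν γ.symm := by
  intro B hB hBs
  have hm := measurableSet_image γ.symm hB hBs
  have hs : γ.symm '' B ⊆ γ.source := by
    rintro _ ⟨x, hx, rfl⟩
    exact γ.map_target (hBs hx)
  have hBeq : γ '' (γ.symm '' B) = B := by
    rw [Set.image_image]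
    exact (Set.image_congr fun x hx => γ.right_inv (hBs hx)).trans (Set.image_id' B)
  -- Changing variables by `γ` in the integral of the claimed density produces the factor `δ (γ y) y
  -- * δ y (γ y) = 1`.
  have key := h.lintegral_image (g := fun z => ENNReal.ofReal (δ (γ.symm z) z)) hfree hδcont hγ
    hm hs (by
      rw [hBeq]
      exact aemeasurable_ofReal_cocycle hfree hδcont (Γ.symm hγ) hB hBs)
  rw [hBeq] at key
  rw [key, ← setLIntegral_one]
  refine setLIntegral_congr_fun hm fun y hy => ?_
  have r1 := orbitRel_apply hγ (hs hy)
  rw [γ.left_inv (hs hy), ← ENNReal.ofReal_mul (hδ.1 _ _ (orbitRel_symm r1)).le,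
    hδ.2 _ _ _ (orbitRel_symm r1) r1, hδ.self_eq_one, ENNReal.ofReal_one]

/-- By the Lindelöf property countably many of the local domains suffice. Cutting `B` into disjoint
pieces, one in each, both sides are countably additive because `γ` is injective on its source. -/
lemma HasDensityAlong.of_locally [SecondCountableTopology T]
    (h : ∀ x ∈ γ.source, ∃ s, IsOpen s ∧ x ∈ s ∧ HasDensityAlong δ ν (γ.restr s)) :
    HasDensityAlong δ ν γ := by
  intro B hB hBs
  choose! s hso hxs hsd using h
  obtain ⟨t, hts, htc, ht⟩ := TopologicalSpace.countable_cover_nhdsWithin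
    (f := s) (s := γ.source) fun x hx =>
      mem_nhdsWithin_of_mem_nhds ((hso x hx).mem_nhds (hxs x hx))
  rcases t.eq_empty_or_nonempty with rfl | hne
  · have : B = ∅ := by
      refine Set.subset_empty_iff.1 ((hBs.trans ht).trans ?_)
      simp
    simp [this]
  obtain ⟨a, rfl⟩ := htc.exists_eq_range hne
  let C : ℕ → Set T := fun n => B ∩ disjointed (fun n => s (a n)) n
  have hCm : ∀ n, MeasurableSet (C n) := fun n =>
    hB.inter (MeasurableSet.disjointed (fun n => (hso _ (hts ⟨n, rfl⟩)).measurableSet) n)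
  have hCd : Pairwise (Function.onFun Disjoint C) := fun i j hij =>
    (disjoint_disjointed (fun n => s (a n)) hij).mono Set.inter_subset_right
      Set.inter_subset_right
  have hCB : ⋃ n, C n = B := by
    rw [← Set.inter_iUnion, iUnion_disjointed]
    refine Set.inter_eq_left.2 (hBs.trans (ht.trans ?_))
    simp
  have hCs : ∀ n, C n ⊆ γ.source := fun n => Set.inter_subset_left.trans hBs
  have himd : Pairwise (Function.onFun Disjoint fun n => γ '' C n) := fun i j hij =>
    (hCd hij).image γ.injOn (hCs i) (hCs j)
  rw [← hCB, Set.image_iUnion, measure_iUnion himd fun n => measurableSet_image γ (hCm n) (hCs n),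
    lintegral_iUnion hCm hCd]
  refine tsum_congr fun n => hsd (a n) (hts ⟨n, rfl⟩) (C n) (hCm n) ?_
  rw [OpenPartialHomeomorph.restr_source, (hso _ (hts ⟨n, rfl⟩)).interior_eq]
  exact fun x hx => ⟨hCs n hx, disjointed_subset (fun n => s (a n)) n hx.2⟩

/-- It suffices to check the Radon-Nikodym property on a generating set. -/
lemma hasRadonNikodymCocycle_of_generates [SecondCountableTopology T] [SFinite ν]
    [ClosedUnderRestriction Γ] {S : Set (OpenPartialHomeomorph T T)}
    (hS : Generates Γ S) (hδ : IsCocycle Γ δ) (hfree : ActsFreely Γ)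
    (hδcont : IsContinuousCocycle Γ δ) (h : ∀ γ ∈ S, HasDensityAlong δ ν γ) :
    HasRadonNikodymCocycle Γ δ ν := by
  -- Membership in `Γ` is kept as part of the condition, since the cocycle is controlled only on the
  -- orbits of `Γ`.
  let G : StructureGroupoid T :=
    { members := {γ | γ ∈ Γ ∧ HasDensityAlong δ ν γ}
      trans' := fun e e' he he' =>
        ⟨Γ.trans he.1 he'.1, he.2.trans he'.2 hδ hfree hδcont he.1 he'.1⟩
      symm' := fun e he => ⟨Γ.symm he.1, he.2.symm hδ hfree hδcont he.1⟩
      id_mem' := by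
        refine ⟨Γ.id_mem, fun B hB _ => ?_⟩
        simp [hδ.self_eq_one]
      locality' := fun e he => by
        refine ⟨Γ.locality fun x hx => ?_, HasDensityAlong.of_locally fun x hx => ?_⟩
        · obtain ⟨s, h1, h2, h3⟩ := he x hx
          exact ⟨s, h1, h2, h3.1⟩
        · obtain ⟨s, h1, h2, h3⟩ := he x hx
          exact ⟨s, h1, h2, h3.2⟩
      mem_of_eqOnSource' := fun e e' he hee' => by
        refine ⟨Γ.mem_of_eqOnSource he.1 hee', fun B hB hBs => ?_⟩
        have hEq : Set.EqOn e' e B := hee'.2.mono hBs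
        rw [hEq.image_eq, he.2 B hB (hBs.trans hee'.1.subset)]
        refine setLIntegral_congr_fun hB fun y hy => ?_
        simp only [hEq hy] }
  have hG : ClosedUnderRestriction G := by
    refine ⟨fun {e} he s hs => ⟨closedUnderRestriction' he.1 hs, fun B hB hBs => ?_⟩⟩
    rw [OpenPartialHomeomorph.restr_source] at hBs
    exact he.2 B hB (hBs.trans Set.inter_subset_left)
  have hle : Γ ≤ G := hS.2 G hG fun γ hγ => ⟨hS.1 γ hγ, h γ hγ⟩
  exact fun γ hγ => (hle hγ).2

lemma HasRadonNikodymCocycle.measure_image_eq_zero_iff (h : HasRadonNikodymCocycle Γ δ ν)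
    (hδ : IsCocycle Γ δ) (hfree : ActsFreely Γ) (hδcont : IsContinuousCocycle Γ δ)
    (hγ : γ ∈ Γ) (hB : MeasurableSet B) (hBs : B ⊆ γ.source) :
    ν (γ '' B) = 0 ↔ ν B = 0 := by
  rw [h γ hγ B hB hBs,
    lintegral_eq_zero_iff' (aemeasurable_ofReal_cocycle hfree hδcont hγ hB hBs)]
  constructor
  · intro h0
    rw [Filter.EventuallyEq, ae_restrict_iff' hB] at h0
    refine measure_mono_null ?_ h0
    intro x hx h1
    have := h1 hx
    have hpos := hδ.1 _ _ (orbitRel_symm (orbitRel_apply hγ (hBs hx)))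
    simp only [Pi.zero_apply, ENNReal.ofReal_eq_zero] at this
    linarith
  · intro h0
    rw [Measure.restrict_eq_zero.2 h0]
    exact ae_zero.symm ▸ Filter.eventually_bot

end RadonNikodym

end Averaging

namespace Averaging

/-! ### The orbit graph -/

section Graph

variable {T : Type*} [TopologicalSpace T] {Γ : StructureGroupoid T}
  {S : Set (OpenPartialHomeomorph T T)} {x y z w : T} {δ : T → T → ℝ}

lemma orbitGraph_adj : (orbitGraph S).Adj z w ↔
    z ≠ w ∧ ((∃ γ ∈ S, z ∈ γ.source ∧ γ z = w) ∨ ∃ γ ∈ S, w ∈ γ.source ∧ γ w = z) :=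
  SimpleGraph.fromRel_adj _ _ _

lemma orbitRel_of_adj (hS : ∀ γ ∈ S, γ ∈ Γ) (h : (orbitGraph S).Adj z w) :
    (z, w) ∈ orbitRel Γ := by
  obtain ⟨-, ⟨γ, hγ, hz, rfl⟩ | ⟨γ, hγ, hw, rfl⟩⟩ := orbitGraph_adj.1 h
  · exact orbitRel_apply (hS γ hγ) hz
  · exact orbitRel_symm (orbitRel_apply (hS γ hγ) hw)

/-- The finite family `e` of elements of `Γ` enumerates the oriented edges of the orbit graph. -/
def EnumeratesEdges (Γ : StructureGroupoid T) (S : Set (OpenPartialHomeomorph T T)) {m : ℕ}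
    (e : Fin m → OpenPartialHomeomorph T T) : Prop :=
  (∀ i, e i ∈ Γ) ∧
    ∀ z w, (orbitGraph S).Adj z w ↔ z ≠ w ∧ ∃ i, z ∈ (e i).source ∧ e i z = w

/-- Adjoining the inverses of the generators makes every oriented edge the action of some member of
the family. -/
lemma exists_enumeratesEdges (hS : ∀ γ ∈ S, γ ∈ Γ) (hSfin : S.Finite) :
    ∃ (m : ℕ) (e : Fin m → OpenPartialHomeomorph T T), EnumeratesEdges Γ S e := by
  have hfin : (S ∪ OpenPartialHomeomorph.symm '' S).Finite := hSfin.union (hSfin.image _)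
  obtain ⟨m, e, -, he⟩ := hfin.fin_param
  have hmem : ∀ η, (∃ i, e i = η) ↔ η ∈ S ∪ OpenPartialHomeomorph.symm '' S := fun η => by
    rw [← he]
    rfl
  refine ⟨m, e, fun i => ?_, fun z w => ?_⟩
  · rcases (hmem (e i)).1 ⟨i, rfl⟩ with h | ⟨γ, hγ, h⟩
    · exact hS _ h
    · exact h ▸ Γ.symm (hS γ hγ)
  · rw [orbitGraph_adj]
    refine and_congr_right fun _ => ⟨?_, ?_⟩
    · rintro (⟨γ, hγ, hz, rfl⟩ | ⟨γ, hγ, hw, rfl⟩)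
      · obtain ⟨i, rfl⟩ := (hmem γ).2 (Or.inl hγ)
        exact ⟨i, hz, rfl⟩
      · obtain ⟨i, hi⟩ := (hmem γ.symm).2 (Or.inr ⟨γ, hγ, rfl⟩)
        refine ⟨i, ?_, ?_⟩
        · rw [hi]
          exact γ.map_source hw
        · rw [hi]
          exact γ.left_inv hw
    · rintro ⟨i, hz, hw⟩
      rcases (hmem (e i)).1 ⟨i, rfl⟩ with h | ⟨γ, hγ, h⟩
      · exact Or.inl ⟨_, h, hz, hw⟩
      · rw [← h] at hz hw
        refine Or.inr ⟨γ, hγ, ?_, ?_⟩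
        · rw [← hw]
          exact γ.map_target hz
        · rw [← hw]
          exact γ.right_inv hz

/-- The points at which the value of `e i` is a neighbour that is not a value of an earlier member
of the family. -/
def branchSet {m : ℕ} (e : Fin m → OpenPartialHomeomorph T T) (i : Fin m) : Set T :=
  {x | x ∈ (e i).source ∧ e i x ≠ x ∧ ∀ j < i, x ∈ (e j).source → e j x ≠ e i x}

variable {m : ℕ} {e : Fin m → OpenPartialHomeomorph T T}

lemma branchSet_subset_source (i : Fin m) : branchSet e i ⊆ (e i).source := fun _ hx => hx.1

lemma image_branchSet_subset_target (i : Fin m) : e i '' branchSet e i ⊆ (e i).target := by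
  rintro _ ⟨x, hx, rfl⟩
  exact (e i).map_source hx.1

lemma symm_image_image_branchSet (i : Fin m) :
    (e i).symm '' (e i '' branchSet e i) = branchSet e i := by
  rw [Set.image_image]
  exact (Set.image_congr fun x hx => (e i).left_inv hx.1).trans (Set.image_id' _)

lemma eq_of_mem_branchSet {i j : Fin m} (hi : x ∈ branchSet e i) (hj : x ∈ branchSet e j)
    (h : e i x = e j x) : i = j := by
  rcases lt_trichotomy i j with hij | hij | hij
  · exact absurd h (hj.2.2 i hij hi.1)
  · exact hij
  · exact absurd h.symm (hi.2.2 j hij hj.1)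

/-- Taking the least index that produces `w` puts `z` in the corresponding branch set. With
`eq_of_mem_branchSet`, each oriented edge has exactly one index, so sums over neighbours become sums
over `i` without repetition. -/
lemma EnumeratesEdges.adj_iff (he : EnumeratesEdges Γ S e) :
    (orbitGraph S).Adj z w ↔ ∃ i, z ∈ branchSet e i ∧ e i z = w := by
  rw [he.2]
  constructor
  · rintro ⟨hne, hi⟩
    obtain ⟨i, ⟨hi1, hi2⟩, hmin⟩ := wellFounded_lt.has_min
      {i | z ∈ (e i).source ∧ e i z = w} hi
    refine ⟨i, ⟨hi1, hi2 ▸ hne.symm, fun j hj hzj h => ?_⟩, hi2⟩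
    exact hmin j ⟨hzj, h.trans hi2⟩ hj
  · rintro ⟨i, hi, rfl⟩
    exact ⟨hi.2.1.symm, i, hi.1, rfl⟩

open Classical in
lemma EnumeratesEdges.finsum_neighborSet {M : Type*} [AddCommMonoid M]
    (he : EnumeratesEdges Γ S e) (g : T → M) (z : T) :
    ∑ᶠ w ∈ (orbitGraph S).neighborSet z, g w =
      ∑ i, (branchSet e i).indicator (fun x => g (e i x)) z := by
  have hN : (orbitGraph S).neighborSet z =
      ((Finset.univ.filter fun i => z ∈ branchSet e i).image fun i => e i z : Finset T) := by
    ext w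
    simp [he.adj_iff]
  rw [hN, finsum_mem_coe_finset, Finset.sum_image, Finset.sum_filter]
  · rfl
  · intro i hi j hj h
    simp only [Finset.coe_filter, Finset.mem_univ, true_and, Set.mem_ofPred_eq] at hi hj
    exact eq_of_mem_branchSet hi hj h

open Classical in
-- Adjacency is symmetric, so the neighbours of `z` can also be listed through the edges arriving at
-- `z`. The outgoing and incoming listings are matched term by term by `e i` in the mass transport
-- argument.
lemma EnumeratesEdges.finsum_neighborSet_symm {M : Type*} [AddCommMonoid M]
    (he : EnumeratesEdges Γ S e) (g : T → M) (z : T) :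
    ∑ᶠ w ∈ (orbitGraph S).neighborSet z, g w =
      ∑ i, (e i '' branchSet e i).indicator (fun x => g ((e i).symm x)) z := by
  have hinv : ∀ {i}, z ∈ e i '' branchSet e i →
      (e i).symm z ∈ branchSet e i ∧ e i ((e i).symm z) = z := by
    rintro i ⟨x, hx, rfl⟩
    rw [(e i).left_inv hx.1]
    exact ⟨hx, rfl⟩
  have hN : (orbitGraph S).neighborSet z =
      ((Finset.univ.filter fun i => z ∈ e i '' branchSet e i).image
        fun i => (e i).symm z : Finset T) := by
    ext w
    simp only [SimpleGraph.mem_neighborSet, (orbitGraph S).adj_comm z w, he.adj_iff,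
      Finset.coe_image, Finset.coe_filter, Finset.mem_univ, true_and, Set.mem_image,
      Set.mem_ofPred_eq]
    constructor
    · rintro ⟨i, hi, rfl⟩
      exact ⟨i, ⟨w, hi, rfl⟩, (e i).left_inv hi.1⟩
    · rintro ⟨i, hi, rfl⟩
      exact ⟨i, hinv hi⟩
  rw [hN, finsum_mem_coe_finset, Finset.sum_image, Finset.sum_filter]
  · rfl
  · intro i hi j hj h
    simp only [Finset.coe_filter, Finset.mem_univ, true_and, Set.mem_ofPred_eq] at hi hj
    obtain ⟨hi1, hi2⟩ := hinv hi
    obtain ⟨hj1, hj2⟩ := hinv hj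
    simp only at h
    rw [← h] at hj1 hj2
    exact eq_of_mem_branchSet hi1 hj1 (hi2.trans hj2.symm)

lemma EnumeratesEdges.finite_neighborSet (he : EnumeratesEdges Γ S e) (z : T) :
    ((orbitGraph S).neighborSet z).Finite := by
  refine (Set.finite_range fun i => e i z).subset fun w hw => ?_
  obtain ⟨i, -, hi⟩ := he.adj_iff.1 hw
  exact ⟨i, hi⟩

lemma EnumeratesEdges.deg_eq (he : EnumeratesEdges Γ S e) (z : T) :
    deg S z = ∑ i, (branchSet e i).indicator (fun _ => 1) z := by
  rw [deg, Set.ncard_eq_toFinset_card _ (he.finite_neighborSet z), Finset.card_eq_sum_ones,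
    ← finsum_mem_eq_finite_toFinset_sum, he.finsum_neighborSet]

lemma EnumeratesEdges.deg_le (he : EnumeratesEdges Γ S e) (z : T) : deg S z ≤ m := by
  rw [he.deg_eq]
  calc ∑ i, (branchSet e i).indicator (fun _ => 1) z ≤ ∑ _i : Fin m, 1 :=
        Finset.sum_le_sum fun i _ => Set.indicator_le_self' (fun _ _ => zero_le) z
    _ = m := by simp

/-- Since `1 / 0 = 0`, harmonicity at a vertex without neighbours would read `δ z z = 0`, whereas `δ
z z = 1`. -/
lemma deg_pos (hδ : IsCocycle Γ δ) (hδharm : IsHarmonicCocycle Γ S δ) (z : T) : 0 < deg S z := by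
  rw [Nat.pos_iff_ne_zero]
  intro h
  have h1 := hδharm z z (orbitRel_refl z)
  rw [hδ.self_eq_one, h] at h1
  simp at h1

lemma IsHarmonicCocycle.finsum_eq (hδ : IsCocycle Γ δ) (hδharm : IsHarmonicCocycle Γ S δ)
    (h : (y, z) ∈ orbitRel Γ) :
    ∑ᶠ w ∈ (orbitGraph S).neighborSet z, δ w y = deg S z * δ z y := by
  have hd : (deg S z : ℝ) ≠ 0 := by exact_mod_cast (deg_pos hδ hδharm z).ne'
  rw [hδharm y z h]
  field_simp

/-- The Harnack inequality along an edge. -/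
lemma EnumeratesEdges.cocycle_le (he : EnumeratesEdges Γ S e) (hδ : IsCocycle Γ δ)
    (hδharm : IsHarmonicCocycle Γ S δ) (hS : ∀ γ ∈ S, γ ∈ Γ) (h : (orbitGraph S).Adj z w) :
    δ w z ≤ m := by
  -- The values `δ w z` at the neighbours are positive and add up to `deg S z ≤ m`.
  have h1 := hδharm.finsum_eq hδ (orbitRel_refl z)
  rw [hδ.self_eq_one, mul_one, finsum_mem_eq_finite_toFinset_sum _ (he.finite_neighborSet z)] at h1
  calc δ w z ≤ ∑ w ∈ (he.finite_neighborSet z).toFinset, δ w z := by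
        refine Finset.single_le_sum (f := fun w => δ w z) (fun v hv => ?_) ?_
        · refine (hδ.1 _ _ (orbitRel_symm (orbitRel_of_adj hS ?_))).le
          simpa using hv
        · simpa using h
    _ = deg S z := h1
    _ ≤ m := by exact_mod_cast he.deg_le z

end Graph

/-! ### Weights of finite sets -/

section Weight

variable {T : Type*} [TopologicalSpace T] {Γ : StructureGroupoid T}
  {S : Set (OpenPartialHomeomorph T T)} {y : T} {δ : T → T → ℝ}
  {m : ℕ} {e : Fin m → OpenPartialHomeomorph T T}

lemma weight_coe_finset {X : Type*} (δ : X → X → ℝ) (y : X) (B : Finset X) :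
    weight δ y (B : Set X) = ∑ z ∈ B, δ z y :=
  finsum_mem_coe_finset _ _

lemma sum_union_le {ι : Type*} [DecidableEq ι] {s t : Finset ι} {f : ι → ℝ}
    (hf : ∀ i ∈ s, 0 ≤ f i) : ∑ i ∈ s ∪ t, f i ≤ ∑ i ∈ s, f i + ∑ i ∈ t, f i := by
  rw [← Finset.sum_union_inter]
  exact le_add_of_nonneg_right
    (Finset.sum_nonneg fun i hi => hf i (Finset.mem_of_mem_inter_left hi))

lemma sum_biUnion_le {ι κ : Type*} [DecidableEq ι] (s : Finset κ) (t : κ → Finset ι) {f : ι → ℝ}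
    (hf : ∀ k ∈ s, ∀ i ∈ t k, 0 ≤ f i) :
    ∑ i ∈ s.biUnion t, f i ≤ ∑ k ∈ s, ∑ i ∈ t k, f i := by
  classical
  induction s using Finset.induction_on with
  | empty => simp
  | insert a s ha ih =>
    rw [Finset.biUnion_insert, Finset.sum_insert ha]
    refine (sum_union_le (hf a (Finset.mem_insert_self a s))).trans ?_
    gcongr
    exact ih fun k hk => hf k (Finset.mem_insert_of_mem hk)

/-- Take for `C` the set `B` with all its neighbours. By harmonicity the neighbours of `b` have
total weight `deg b * δ b y ≤ m * δ b y`, whence the factor `1 + m`. -/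
lemma EnumeratesEdges.exists_neighborhood (he : EnumeratesEdges Γ S e) (hδ : IsCocycle Γ δ)
    (hδharm : IsHarmonicCocycle Γ S δ) (hS : ∀ γ ∈ S, γ ∈ Γ) (B : Finset T)
    (hB : ∀ z ∈ B, (y, z) ∈ orbitRel Γ) :
    ∃ C : Finset T, (∀ z ∈ C, (y, z) ∈ orbitRel Γ) ∧ B ⊆ C ∧
      (∀ b ∈ B, ∀ z, (orbitGraph S).Adj z b → z ∈ C) ∧
      ∑ z ∈ C, δ z y ≤ (1 + m) * ∑ z ∈ B, δ z y := by
  classical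
  let N : T → Finset T := fun z => (he.finite_neighborSet z).toFinset
  have hN : ∀ z w, w ∈ N z ↔ (orbitGraph S).Adj z w := fun z w => by simp [N]
  have hNorb : ∀ b ∈ B, ∀ z ∈ N b, (y, z) ∈ orbitRel Γ := fun b hb z hz =>
    orbitRel_trans (hB b hb) (orbitRel_of_adj hS ((hN b z).1 hz))
  refine ⟨B ∪ B.biUnion N, ?_, Finset.subset_union_left, ?_, ?_⟩
  · intro z hz
    rcases Finset.mem_union.1 hz with hz | hz
    · exact hB z hz
    · obtain ⟨b, hb, hz⟩ := Finset.mem_biUnion.1 hz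
      exact hNorb b hb z hz
  · intro b hb z hz
    exact Finset.mem_union_right _ (Finset.mem_biUnion.2 ⟨b, hb, (hN b z).2 hz.symm⟩)
  · refine (sum_union_le fun z hz => (hδ.1 _ _ (orbitRel_symm (hB z hz))).le).trans ?_
    have h1 := sum_biUnion_le B N (f := fun z => δ z y) fun b hb z hz =>
      (hδ.1 _ _ (orbitRel_symm (hNorb b hb z hz))).le
    have h2 : ∑ b ∈ B, ∑ z ∈ N b, δ z y ≤ m * ∑ b ∈ B, δ b y := by
      rw [Finset.mul_sum]
      refine Finset.sum_le_sum fun b hb => ?_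
      have h3 := hδharm.finsum_eq hδ (hB b hb)
      rw [finsum_mem_eq_finite_toFinset_sum _ (he.finite_neighborSet b)] at h3
      rw [h3]
      exact mul_le_mul_of_nonneg_right (by exact_mod_cast he.deg_le b)
        (hδ.1 _ _ (orbitRel_symm (hB b hb))).le
    linarith

lemma EnumeratesEdges.exists_iterated_neighborhood (he : EnumeratesEdges Γ S e)
    (hδ : IsCocycle Γ δ) (hδharm : IsHarmonicCocycle Γ S δ) (hS : ∀ γ ∈ S, γ ∈ Γ) (B : Finset T)
    (hB : ∀ z ∈ B, (y, z) ∈ orbitRel Γ) (N : ℕ) :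
    ∃ C : Finset T, (∀ z ∈ C, (y, z) ∈ orbitRel Γ) ∧
      (∀ b ∈ B, ∀ z, ∀ p : (orbitGraph S).Walk z b, p.length ≤ N → z ∈ C) ∧
      ∑ z ∈ C, δ z y ≤ (1 + m) ^ N * ∑ z ∈ B, δ z y := by
  induction N with
  | zero =>
    refine ⟨B, hB, fun b hb z p hp => ?_, by simp⟩
    rwa [SimpleGraph.Walk.eq_of_length_eq_zero (Nat.le_zero.1 hp)]
  | succ N ih =>
    obtain ⟨C, hC, hCB, hsum⟩ := ih
    obtain ⟨C', hC', hsub, hadj, hsum'⟩ := he.exists_neighborhood hδ hδharm hS C hC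
    refine ⟨C', hC', fun b hb z p hp => ?_, ?_⟩
    · cases p with
      | nil => exact hsub (hCB b hb b .nil (Nat.zero_le _))
      | cons h q =>
        refine hadj _ (hCB b hb _ q ?_) z h
        simpa using hp
    · calc ∑ z ∈ C', δ z y ≤ (1 + m) * ∑ z ∈ C, δ z y := hsum'
        _ ≤ (1 + m) * ((1 + m) ^ N * ∑ z ∈ B, δ z y) := by gcongr
        _ = _ := by ring

lemma finite_differenceSet (γ : OpenPartialHomeomorph T T) (A : Finset T) :
    (differenceSet γ (A : Set T) ∩ γ.source).Finite := by
  refine (A.finite_toSet.union ((A.finite_toSet.image γ.symm))).subset ?_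
  rintro x ⟨hx | hx, hs⟩
  · exact Or.inl hx.1
  · exact Or.inr ⟨γ x, hx.2.2, γ.left_inv hs⟩

lemma orbitRel_of_mem_differenceSet {γ : OpenPartialHomeomorph T T} (hγ : γ ∈ Γ) {A : Finset T}
    (hA : ∀ z ∈ A, (y, z) ∈ orbitRel Γ) {x : T}
    (hx : x ∈ differenceSet γ (A : Set T) ∩ γ.source) : (y, x) ∈ orbitRel Γ := by
  obtain ⟨hx | hx, hs⟩ := hx
  · exact hA x hx.1
  · exact orbitRel_trans (hA _ hx.2.2) (orbitRel_symm (orbitRel_apply hγ hs))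

/-- Follow the walk until it leaves `A`. If it never does, its end lies in `A ∩ T₁`; otherwise the
edge by which it leaves comes from a generator whose difference set contains one end of that edge.
-/
lemma exists_walk_to_boundary {A : Finset T} {T₁ : Set T} {z t : T}
    (p : (orbitGraph S).Walk z t) (ht : t ∈ T₁) (hz : z ∈ A) :
    ∃ b, ((b ∈ A ∧ b ∈ T₁) ∨ ∃ γ ∈ S, b ∈ differenceSet γ (A : Set T) ∩ γ.source) ∧
      ∃ q : (orbitGraph S).Walk z b, q.length ≤ p.length := by
  induction p with
  | nil => exact ⟨_, Or.inl ⟨hz, ht⟩, .nil, le_rfl⟩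
  | @cons u v w h p ih =>
    by_cases hv : v ∈ A
    · obtain ⟨b, hb, q, hq⟩ := ih ht hv
      exact ⟨b, hb, .cons h q, by simpa using hq⟩
    · obtain ⟨-, ⟨γ, hγ, hu, rfl⟩ | ⟨γ, hγ, hw, rfl⟩⟩ := orbitGraph_adj.1 h
      · exact ⟨u, Or.inr ⟨γ, hγ, Or.inl ⟨hz, fun h' => hv h'.2⟩, hu⟩, .nil, Nat.zero_le _⟩
      -- Here the generator points back into `A`, so the point of the difference set is the outer
      -- end of the edge, one step further.
      · exact ⟨v, Or.inr ⟨γ, hγ, Or.inr ⟨hv, hw, hz⟩, hw⟩, .cons h .nil, by simp⟩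

open Classical in
/-- A finite set all of whose points are close to `T₁` has a definite proportion of its weight
in `T₁`, up to the weight of its difference sets. -/
lemma EnumeratesEdges.weight_le (he : EnumeratesEdges Γ S e)
    (hδ : IsCocycle Γ δ) (hδharm : IsHarmonicCocycle Γ S δ) (hS : ∀ γ ∈ S, γ ∈ Γ)
    (hSfin : S.Finite) {T₁ : Set T} {N : ℕ}
    (hN : ∀ y : T, ∃ z ∈ T₁, ∃ p : (orbitGraph S).Walk y z, p.length ≤ N)
    {A : Finset T} (hA : ∀ z ∈ A, (y, z) ∈ orbitRel Γ) :
    weight δ y A ≤ (1 + m) ^ N * (∑ z ∈ A with z ∈ T₁, δ z y +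
      ∑ γ ∈ hSfin.toFinset, weight δ y (differenceSet γ (A : Set T) ∩ γ.source)) := by
  let D : OpenPartialHomeomorph T T → Finset T := fun γ => (finite_differenceSet γ A).toFinset
  have hD : ∀ γ x, x ∈ D γ ↔ x ∈ differenceSet γ (A : Set T) ∩ γ.source := fun γ x => by
    simp only [D, Set.Finite.mem_toFinset]
  have hDw : ∀ γ, weight δ y (differenceSet γ (A : Set T) ∩ γ.source) = ∑ z ∈ D γ, δ z y :=
    fun γ => finsum_mem_eq_finite_toFinset_sum _ _
  have hDorb : ∀ γ ∈ hSfin.toFinset, ∀ z ∈ D γ, (y, z) ∈ orbitRel Γ := fun γ hγ z hz =>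
    orbitRel_of_mem_differenceSet (hS γ (by simpa using hγ)) hA ((hD γ z).1 hz)
  let B : Finset T := (A.filter fun z => z ∈ T₁) ∪ hSfin.toFinset.biUnion D
  have hB : ∀ z ∈ B, (y, z) ∈ orbitRel Γ := by
    intro z hz
    rcases Finset.mem_union.1 hz with hz | hz
    · exact hA z (Finset.mem_filter.1 hz).1
    · obtain ⟨γ, hγ, hz⟩ := Finset.mem_biUnion.1 hz
      exact hDorb γ hγ z hz
  obtain ⟨C, hC, hCB, hsum⟩ := he.exists_iterated_neighborhood hδ hδharm hS B hB N
  have hAC : A ⊆ C := by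
    intro z hz
    obtain ⟨t, ht, p, hp⟩ := hN z
    obtain ⟨b, hb, q, hq⟩ := exists_walk_to_boundary p ht hz
    refine hCB b ?_ z q (hq.trans hp)
    rcases hb with hb | ⟨γ, hγ, hb⟩
    · exact Finset.mem_union_left _ (Finset.mem_filter.2 hb)
    · exact Finset.mem_union_right _
        (Finset.mem_biUnion.2 ⟨γ, by simpa using hγ, (hD γ b).2 hb⟩)
  rw [weight_coe_finset]
  calc ∑ z ∈ A, δ z y ≤ ∑ z ∈ C, δ z y := Finset.sum_le_sum_of_subset_of_nonneg hAC
        fun z hz _ => (hδ.1 _ _ (orbitRel_symm (hC z hz))).le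
    _ ≤ (1 + m) ^ N * ∑ z ∈ B, δ z y := hsum
    _ ≤ _ := by
      gcongr
      refine (sum_union_le fun z hz =>
        (hδ.1 _ _ (orbitRel_symm (hA z (Finset.mem_filter.1 hz).1))).le).trans ?_
      gcongr
      refine (sum_biUnion_le _ _ fun γ hγ z hz =>
        (hδ.1 _ _ (orbitRel_symm (hDorb γ hγ z hz))).le).trans ?_
      exact (Finset.sum_congr rfl fun γ _ => (hDw γ).symm).le

open Classical in
/-- The weighted mass of the image of `K` and the mass of `K` with density `δ (γ x, x)` differ
by a multiple of the weight of the difference set. -/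
lemma abs_sum_image_sub_sum_le (hδ : IsCocycle Γ δ) {γ : OpenPartialHomeomorph T T} (hγ : γ ∈ Γ)
    {A : Finset T} (hA : ∀ z ∈ A, (y, z) ∈ orbitRel Γ) {K : Set T} (hK : K ⊆ γ.source) {M : ℝ}
    (hM : ∀ x ∈ K, δ (γ x) x ≤ M) (hM0 : 0 ≤ M) :
    |∑ z ∈ A with z ∈ γ '' K, δ z y - ∑ x ∈ A with x ∈ K, δ (γ x) x * δ x y| ≤
      M * weight δ y (differenceSet γ (A : Set T) ∩ γ.source) := by
  let D : Finset T := (finite_differenceSet γ A).toFinset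
  have hD : ∀ x, x ∈ D ↔ x ∈ differenceSet γ (A : Set T) ∩ γ.source := fun x => by
    simp only [D, Set.Finite.mem_toFinset]
  have hDw : weight δ y (differenceSet γ (A : Set T) ∩ γ.source) = ∑ z ∈ D, δ z y :=
    finsum_mem_eq_finite_toFinset_sum _ _
  -- `X` is the part of `K` mapped into `A`, and `G` is `A ∩ K`. A point in just one of them lies in
  -- the difference set.
  let X : Finset T := (A.filter fun z => z ∈ γ '' K).image γ.symm
  let G : Finset T := A.filter fun x => x ∈ K
  have hX : ∀ x, x ∈ X ↔ x ∈ K ∧ γ x ∈ A := by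
    intro x
    simp only [X, Finset.mem_image, Finset.mem_filter]
    constructor
    · rintro ⟨_, ⟨hz, x', hx', rfl⟩, rfl⟩
      rw [γ.left_inv (hK hx')]
      exact ⟨hx', hz⟩
    · rintro ⟨hx, hxA⟩
      exact ⟨γ x, ⟨hxA, x, hx, rfl⟩, γ.left_inv (hK hx)⟩
  have hG : ∀ x, x ∈ G ↔ x ∈ A ∧ x ∈ K := fun x => Finset.mem_filter
  have hXorb : ∀ x ∈ X, (y, x) ∈ orbitRel Γ := fun x hx =>
    orbitRel_trans (hA _ ((hX x).1 hx).2) (orbitRel_symm (orbitRel_apply hγ (hK ((hX x).1 hx).1)))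
  have hsum : ∑ z ∈ A with z ∈ γ '' K, δ z y = ∑ x ∈ X, δ (γ x) x * δ x y := by
    rw [Finset.sum_image]
    · refine Finset.sum_congr rfl fun z hz => ?_
      obtain ⟨hzA, x, hx, rfl⟩ := Finset.mem_filter.1 hz
      rw [γ.left_inv (hK hx)]
      have r := orbitRel_symm (orbitRel_apply hγ (hK hx))
      exact (hδ.2 _ _ _ r (orbitRel_trans (orbitRel_symm r) (orbitRel_symm (hA _ hzA)))).symm
    · intro z hz z' hz' h
      obtain ⟨-, x, hx, rfl⟩ := Finset.mem_filter.1 hz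
      obtain ⟨-, x', hx', rfl⟩ := Finset.mem_filter.1 hz'
      rw [γ.left_inv (hK hx), γ.left_inv (hK hx')] at h
      rw [h]
  have hbound : ∀ s : Finset T, s ⊆ D → (∀ x ∈ s, x ∈ K) →
      0 ≤ ∑ x ∈ s, δ (γ x) x * δ x y ∧ ∑ x ∈ s, δ (γ x) x * δ x y ≤ M * ∑ x ∈ D, δ x y := by
    intro s hs hsK
    have hpos : ∀ x ∈ D, 0 ≤ δ x y := fun x hx =>
      (hδ.1 _ _ (orbitRel_symm (orbitRel_of_mem_differenceSet hγ hA ((hD x).1 hx)))).le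
    refine ⟨Finset.sum_nonneg fun x hx => mul_nonneg ?_ (hpos x (hs hx)), ?_⟩
    · exact (hδ.1 _ _ (orbitRel_symm (orbitRel_apply hγ (hK (hsK x hx))))).le
    · rw [Finset.mul_sum]
      calc ∑ x ∈ s, δ (γ x) x * δ x y ≤ ∑ x ∈ s, M * δ x y :=
            Finset.sum_le_sum fun x hx =>
              mul_le_mul_of_nonneg_right (hM x (hsK x hx)) (hpos x (hs hx))
        _ ≤ ∑ x ∈ D, M * δ x y := Finset.sum_le_sum_of_subset_of_nonneg hs
              fun x hx _ => mul_nonneg hM0 (hpos x hx)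
  have h1 := hbound (X \ G) (fun x hx => by
    rw [Finset.mem_sdiff, hX, hG] at hx
    exact (hD x).2 ⟨Or.inr ⟨fun h => hx.2 ⟨h, hx.1.1⟩, hK hx.1.1, hx.1.2⟩, hK hx.1.1⟩)
    fun x hx => ((hX x).1 (Finset.mem_sdiff.1 hx).1).1
  have h2 := hbound (G \ X) (fun x hx => by
    rw [Finset.mem_sdiff, hX, hG] at hx
    exact (hD x).2 ⟨Or.inl ⟨hx.1.1, fun h => hx.2 ⟨hx.1.2, h.2⟩⟩, hK hx.1.2⟩)
    fun x hx => ((hG x).1 (Finset.mem_sdiff.1 hx).1).2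
  -- The difference is a sum over `X \ G` minus one over `G \ X`, both nonnegative and at most the
  -- bound, so no factor `2` appears.
  rw [hsum, hDw, ← Finset.sum_sdiff_sub_sum_sdiff, abs_le]
  constructor <;> linarith [h1.1, h1.2, h2.1, h2.2]

lemma IsAveragingSequence.weight_pos {y : ℕ → T} {A : ℕ → Finset T}
    (hA : IsAveragingSequence Γ S δ y A) (hδ : IsCocycle Γ δ) (n : ℕ) : 0 < weight δ (y n) (A n) := by
  rw [weight_coe_finset]
  exact Finset.sum_pos (fun z hz => hδ.1 _ _ (orbitRel_symm (hA.subset_orbit n z hz)))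
    (hA.nonempty n)

end Weight

end Averaging

namespace Averaging

/-! ### Harmonicity of the measure `deg · ν₀` -/

section Harmonic

variable {T : Type*} [TopologicalSpace T] [MeasurableSpace T] {Γ : StructureGroupoid T}
  {S : Set (OpenPartialHomeomorph T T)} {δ : T → T → ℝ}
  {m : ℕ} {e : Fin m → OpenPartialHomeomorph T T} {ν : Measure T}

lemma EnumeratesEdges.isFiniteMeasure_withDensity_deg [IsFiniteMeasure ν]
    (he : EnumeratesEdges Γ S e) :
    IsFiniteMeasure (ν.withDensity fun x => (deg S x : ENNReal)) := by
  refine isFiniteMeasure_withDensity (ne_of_lt ?_)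
  calc ∫⁻ x, (deg S x : ENNReal) ∂ν ≤ ∫⁻ _x, (m : ENNReal) ∂ν :=
        lintegral_mono fun x => Nat.cast_le.2 (he.deg_le x)
    _ = m * ν Set.univ := lintegral_const _
    _ < ⊤ := ENNReal.mul_lt_top (ENNReal.natCast_lt_top m) (measure_lt_top ν _)

variable [T2Space T] [BorelSpace T]

/-- In a Hausdorff space, two continuous maps differ on an open set, so the branch set is a finite
Boolean combination of open sets. -/
lemma measurableSet_branchSet (i : Fin m) : MeasurableSet (branchSet e i) := by
  have h1 : IsOpen ((e i).source ∩ (fun x => (e i x, x)) ⁻¹' (Set.diagonal T)ᶜ) :=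
    ((e i).continuousOn.prodMk continuousOn_id).isOpen_inter_preimage (e i).open_source
      isClosed_diagonal.isOpen_compl
  have h2 : ∀ j, IsOpen (((e i).source ∩ (e j).source) ∩
      (fun x => (e j x, e i x)) ⁻¹' (Set.diagonal T)ᶜ) := fun j =>
    (((e j).continuousOn.mono Set.inter_subset_right).prodMk
      ((e i).continuousOn.mono Set.inter_subset_left)).isOpen_inter_preimage
        ((e i).open_source.inter (e j).open_source) isClosed_diagonal.isOpen_compl
  have heq : branchSet e i = ((e i).source ∩ (fun x => (e i x, x)) ⁻¹' (Set.diagonal T)ᶜ) ∩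
      ⋂ j, ⋂ _ : j < i, ((e j).sourceᶜ ∪ (((e i).source ∩ (e j).source) ∩
        (fun x => (e j x, e i x)) ⁻¹' (Set.diagonal T)ᶜ)) := by
    ext x
    simp only [branchSet, Set.mem_ofPred_eq, Set.mem_inter_iff, Set.mem_preimage,
      Set.mem_compl_iff, Set.mem_diagonal_iff, Set.mem_iInter, Set.mem_union]
    constructor
    · rintro ⟨h1, h2, h3⟩
      refine ⟨⟨h1, h2⟩, fun j hj => ?_⟩
      by_cases hx : x ∈ (e j).source
      · exact Or.inr ⟨⟨h1, hx⟩, h3 j hj hx⟩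
      · exact Or.inl hx
    · rintro ⟨⟨h1, h2⟩, h3⟩
      refine ⟨h1, h2, fun j hj hx => ?_⟩
      rcases h3 j hj with h | h
      · exact absurd hx h
      · exact h.2
  rw [heq]
  exact h1.measurableSet.inter (MeasurableSet.iInter fun j => MeasurableSet.iInter fun _ =>
    (e j).open_source.measurableSet.compl.union (h2 j).measurableSet)

lemma EnumeratesEdges.measurable_deg (he : EnumeratesEdges Γ S e) : Measurable (deg S) := by
  have : deg S = fun z => ∑ i, (branchSet e i).indicator (fun _ => 1) z := funext he.deg_eq
  rw [this]
  exact Finset.measurable_sum _ fun i _ =>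
    measurable_const.indicator (measurableSet_branchSet i)

lemma measurableSet_image_branchSet (i : Fin m) : MeasurableSet (e i '' branchSet e i) :=
  measurableSet_image (e i) (measurableSet_branchSet i) (branchSet_subset_source i)

lemma integrableOn_comp_branchSet [IsFiniteMeasure ν] {f : T → ℝ} (hf : Measurable f) {C : ℝ}
    (hC : ∀ x, |f x| ≤ C) (i : Fin m) :
    IntegrableOn (fun x => f (e i x)) (branchSet e i) ν :=
  Integrable.of_bound (hf.comp_aemeasurable (aemeasurable_of_subset_source (e i)
    (measurableSet_branchSet i) (branchSet_subset_source i))).aestronglyMeasurable C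
    (Eventually.of_forall fun _ => hC _)

lemma EnumeratesEdges.integrableOn_image_branchSet [IsFiniteMeasure ν]
    (he : EnumeratesEdges Γ S e) (hδ : IsCocycle Γ δ) (hfree : ActsFreely Γ)
    (hδcont : IsContinuousCocycle Γ δ) (hδharm : IsHarmonicCocycle Γ S δ)
    (hS : ∀ γ ∈ S, γ ∈ Γ) {f : T → ℝ} (hf : Measurable f) {C : ℝ} (hC : ∀ x, |f x| ≤ C)
    (i : Fin m) :
    IntegrableOn (fun x => δ ((e i).symm x) x * f x) (e i '' branchSet e i) ν := by
  refine Integrable.of_bound (AEMeasurable.mul ?_ hf.aemeasurable).aestronglyMeasurable (m * C) ?_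
  · exact ((continuousOn_cocycle_apply hfree hδcont (Γ.symm (he.1 i))).mono
      (image_branchSet_subset_target i)).aemeasurable (measurableSet_image_branchSet i)
  · refine (ae_restrict_iff' (measurableSet_image_branchSet i)).2 (Eventually.of_forall ?_)
    rintro _ ⟨x, hx, rfl⟩
    have hadj : (orbitGraph S).Adj x (e i x) := he.adj_iff.2 ⟨i, hx, rfl⟩
    rw [(e i).left_inv hx.1, norm_mul, Real.norm_eq_abs, Real.norm_eq_abs,
      abs_of_pos (hδ.1 _ _ (orbitRel_of_adj hS hadj))]
    exact mul_le_mul (he.cocycle_le hδ hδharm hS hadj.symm) (hC _) (abs_nonneg _)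
      (Nat.cast_nonneg _)

/-- The mass transport principle along the edges of the orbit graph. -/
lemma EnumeratesEdges.integral_finsum_neighborSet [IsFiniteMeasure ν]
    (he : EnumeratesEdges Γ S e) (hRN : HasRadonNikodymCocycle Γ δ ν) (hδ : IsCocycle Γ δ)
    (hfree : ActsFreely Γ) (hδcont : IsContinuousCocycle Γ δ)
    (hδharm : IsHarmonicCocycle Γ S δ) (hS : ∀ γ ∈ S, γ ∈ Γ) {f : T → ℝ} (hf : Measurable f)
    {C : ℝ} (hC : ∀ x, |f x| ≤ C) :
    Integrable (fun x => ∑ᶠ w ∈ (orbitGraph S).neighborSet x, f w) ν ∧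
      ∫ x, ∑ᶠ w ∈ (orbitGraph S).neighborSet x, f w ∂ν = ∫ x, deg S x * f x ∂ν := by
  have hInt1 : ∀ i, Integrable ((branchSet e i).indicator fun x => f (e i x)) ν := fun i =>
    (integrable_indicator_iff (measurableSet_branchSet i)).2 (integrableOn_comp_branchSet hf hC i)
  have hInt2 : ∀ i, Integrable
      ((e i '' branchSet e i).indicator fun x => δ ((e i).symm x) x * f x) ν := fun i =>
    (integrable_indicator_iff (measurableSet_image_branchSet i)).2
      (he.integrableOn_image_branchSet hδ hfree hδcont hδharm hS hf hC i)
  -- Harmonicity on the diagonal gives `deg x = ∑_{w ∼ x} δ w x`, read here over incoming edges.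
  have hsum : ∀ x, deg S x * f x = ∑ i,
      (e i '' branchSet e i).indicator (fun x => δ ((e i).symm x) x * f x) x := by
    intro x
    have h := hδharm.finsum_eq hδ (orbitRel_refl x)
    rw [hδ.self_eq_one, mul_one, he.finsum_neighborSet_symm (fun w => δ w x)] at h
    rw [← h, Finset.sum_mul]
    refine Finset.sum_congr rfl fun i _ => ?_
    by_cases hx : x ∈ e i '' branchSet e i
    · simp only [Set.indicator_of_mem hx]
    · simp only [Set.indicator_of_notMem hx, zero_mul]
  simp only [he.finsum_neighborSet, hsum]
  refine ⟨integrable_finsetSum _ fun i _ => hInt1 i, ?_⟩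
  rw [integral_finsetSum _ fun i _ => hInt1 i, integral_finsetSum _ fun i _ => hInt2 i]
  refine Finset.sum_congr rfl fun i _ => ?_
  rw [integral_indicator (measurableSet_branchSet i),
    integral_indicator (measurableSet_image_branchSet i)]
  -- The change of variables by the inverse of `e i` carries the outgoing term on the branch set to
  -- the incoming term on its image.
  have hd : HasDensityAlong δ ν (e i).symm := hRN _ (Γ.symm (he.1 i))
  have key := hd.integral_image (g := fun x => f (e i x)) hδ hfree hδcont (Γ.symm (he.1 i))
    (measurableSet_image_branchSet i) (image_branchSet_subset_target i) (by
      rw [symm_image_image_branchSet]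
      exact (integrableOn_comp_branchSet hf hC i).aestronglyMeasurable)
  rw [symm_image_image_branchSet] at key
  rw [key]
  refine setIntegral_congr_fun (measurableSet_image_branchSet i) fun x hx => ?_
  simp only [(e i).right_inv (image_branchSet_subset_target i hx)]

lemma EnumeratesEdges.measurable_deg_ennreal (he : EnumeratesEdges Γ S e) :
    Measurable fun x => (deg S x : ENNReal) :=
  (measurable_of_countable (fun n : ℕ => (n : ENNReal))).comp he.measurable_deg

lemma EnumeratesEdges.withDensity_deg_eq_zero_iff (he : EnumeratesEdges Γ S e)
    (hδ : IsCocycle Γ δ) (hδharm : IsHarmonicCocycle Γ S δ) (B : Set T) :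
    (ν.withDensity fun x => (deg S x : ENNReal)) B = 0 ↔ ν B = 0 := by
  rw [withDensity_apply_eq_zero he.measurable_deg_ennreal]
  have : {x | (deg S x : ENNReal) ≠ 0} = Set.univ :=
    Set.eq_univ_of_forall fun x => by simpa using (deg_pos hδ hδharm x).ne'
  rw [this, Set.univ_inter]

/-- The product of `deg` and the Laplacian of `f` is `∑_{w ∼ x} f w - deg x * f x`, whose two terms
have equal integrals by mass transport. As `deg` is positive, the weighting does not change the null
sets. -/
lemma EnumeratesEdges.isHarmonicMeasure_withDensity_deg [IsFiniteMeasure ν]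
    (he : EnumeratesEdges Γ S e) (hRN : HasRadonNikodymCocycle Γ δ ν) (hδ : IsCocycle Γ δ)
    (hfree : ActsFreely Γ) (hδcont : IsContinuousCocycle Γ δ)
    (hδharm : IsHarmonicCocycle Γ S δ) (hS : ∀ γ ∈ S, γ ∈ Γ) :
    IsHarmonicMeasure Γ S (ν.withDensity fun x => (deg S x : ENNReal)) := by
  refine ⟨fun γ hγ B hB hBs => ?_, ?_⟩
  · rw [he.withDensity_deg_eq_zero_iff hδ hδharm, he.withDensity_deg_eq_zero_iff hδ hδharm]
    exact hRN.measure_image_eq_zero_iff hδ hfree hδcont hγ hB hBs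
  · rintro f hf ⟨C, hC⟩
    obtain ⟨hInt, heq⟩ :=
      he.integral_finsum_neighborSet hRN hδ hfree hδcont hδharm hS hf hC
    have hlap : ∀ x, (deg S x : ENNReal).toReal • laplacian S f x =
        ∑ᶠ w ∈ (orbitGraph S).neighborSet x, f w - deg S x * f x := by
      intro x
      have hd : (deg S x : ℝ) ≠ 0 := by exact_mod_cast (deg_pos hδ hδharm x).ne'
      rw [ENNReal.toReal_natCast, smul_eq_mul, laplacian]
      field_simp
    have hInt' : Integrable (fun x => deg S x * f x) ν := by
      refine Integrable.of_bound (C := m * C) ?_ (Eventually.of_forall fun x => ?_)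
      · exact (((measurable_of_countable (fun n : ℕ => (n : ℝ))).comp
          he.measurable_deg).mul hf).aestronglyMeasurable
      · rw [norm_mul, Real.norm_natCast, Real.norm_eq_abs]
        exact mul_le_mul (by exact_mod_cast he.deg_le x) (hC x) (abs_nonneg _)
          (Nat.cast_nonneg _)
    have htop : ∀ᵐ x ∂ν, (deg S x : ENNReal) < ⊤ :=
      Eventually.of_forall fun x => ENNReal.natCast_lt_top _
    constructor
    · rw [integrable_withDensity_iff_integrable_smul' he.measurable_deg_ennreal htop]
      simp only [hlap]
      exact hInt.sub hInt'
    · rw [integral_withDensity_eq_integral_toReal_smul he.measurable_deg_ennreal htop]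
      simp only [hlap]
      rw [integral_sub hInt hInt', heq, sub_self]

end Harmonic

end Averaging

namespace Averaging

/-! ### Limits of averaging sequences -/

section Empirical

variable {T : Type*} [MeasurableSpace T]

/-- The normalized weight `B ↦ |B ∩ A|_y / |A|_y` as a measure. -/
noncomputable def averagingMeasure (δ : T → T → ℝ) (y : T) (A : Finset T) : Measure T :=
  ∑ z ∈ A, ENNReal.ofReal (δ z y / weight δ y A) • Measure.dirac z

variable {δ : T → T → ℝ} {y : T} {A : Finset T}

lemma isProbabilityMeasure_averagingMeasure (hA : A.Nonempty) (hδ : ∀ z ∈ A, 0 < δ z y) :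
    IsProbabilityMeasure (averagingMeasure δ y A) := by
  have hW : 0 < weight δ y A := by
    rw [weight_coe_finset]
    exact Finset.sum_pos hδ hA
  refine ⟨?_⟩
  simp only [averagingMeasure, Measure.coe_finsetSum, Finset.sum_apply, Measure.smul_apply,
    measure_univ, smul_eq_mul, mul_one]
  rw [← ENNReal.ofReal_sum_of_nonneg fun z hz => (div_pos (hδ z hz) hW).le, ← Finset.sum_div,
    ← weight_coe_finset, div_self hW.ne', ENNReal.ofReal_one]

lemma integral_averagingMeasure [MeasurableSingletonClass T] (hA : A.Nonempty)
    (hδ : ∀ z ∈ A, 0 < δ z y) (f : T → ℝ) :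
    ∫ x, f x ∂averagingMeasure δ y A = (∑ z ∈ A, f z * δ z y) / weight δ y A := by
  have hW : 0 < weight δ y A := by
    rw [weight_coe_finset]
    exact Finset.sum_pos hδ hA
  rw [averagingMeasure, integral_finsetSum_measure, Finset.sum_div]
  · refine Finset.sum_congr rfl fun z hz => ?_
    rw [integral_smul_measure, integral_dirac,
      ENNReal.toReal_ofReal (div_pos (hδ z hz) hW).le, smul_eq_mul]
    ring
  · intro z _
    exact (integrable_dirac (by simp)).smul_measure ENNReal.ofReal_ne_top

end Empirical

/-! ### Covariance, nontriviality and support of the vague limit -/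

section Limit

variable {T : Type*} [TopologicalSpace T] [T2Space T] [MeasurableSpace T] [BorelSpace T]
  {Γ : StructureGroupoid T} {S : Set (OpenPartialHomeomorph T T)} {δ : T → T → ℝ}
  {y : ℕ → T} {A : ℕ → Finset T} {φ : ℕ → ℕ} {ν : Measure T}

lemma exists_isVagueLimit [LocallyCompactSpace T] [SecondCountableTopology T]
    (hA : IsAveragingSequence Γ S δ y A) (hδ : IsCocycle Γ δ) :
    ∃ (φ : ℕ → ℕ) (ν : Measure T), StrictMono φ ∧ IsFiniteMeasure ν ∧
      IsVagueLimit δ y A φ ν := by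
  have hpos : ∀ n, ∀ z ∈ A n, 0 < δ z (y n) := fun n z hz =>
    hδ.1 _ _ (orbitRel_symm (hA.subset_orbit n z hz))
  obtain ⟨φ, ν, hφ, hν, h⟩ := exists_subseq_tendsto_vague
    (fun n => averagingMeasure δ (y n) (A n))
    fun n => isProbabilityMeasure_averagingMeasure (hA.nonempty n) (hpos n)
  refine ⟨φ, ν, hφ, hν, fun f hf hfc => ?_⟩
  simpa only [integral_averagingMeasure (hA.nonempty _) (hpos _)] using h f hf hfc

open Classical in
-- The boundary of a clopen set is empty, so cutting `g` off outside `K` leaves a continuous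
-- function with compact support.
lemma IsVagueLimit.tendsto_setIntegral (h : IsVagueLimit δ y A φ ν) {K : Set T}
    (hKc : IsCompact K) (hK : IsClopen K) {g : T → ℝ} (hg : ContinuousOn g K) :
    Tendsto (fun k => (∑ z ∈ A (φ k) with z ∈ K, g z * δ z (y (φ k))) /
      weight δ (y (φ k)) (A (φ k))) atTop (𝓝 (∫ x in K, g x ∂ν)) := by
  have hcont : Continuous (K.indicator g) :=
    continuous_indicator (by simp [hK.frontier_eq]) (by rwa [hK.1.closure_eq])
  have hsupp : HasCompactSupport (K.indicator g) :=
    HasCompactSupport.of_support_subset_isCompact hKc Set.support_indicator_subset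
  have h1 := h _ hcont hsupp
  rw [integral_indicator hK.2.measurableSet] at h1
  refine h1.congr fun k => ?_
  rw [Finset.sum_filter]
  congr 1
  refine Finset.sum_congr rfl fun z _ => ?_
  by_cases hz : z ∈ K <;> simp [hz]

open Classical in
lemma IsVagueLimit.tendsto_measureReal (h : IsVagueLimit δ y A φ ν) {K : Set T}
    (hKc : IsCompact K) (hK : IsClopen K) :
    Tendsto (fun k => (∑ z ∈ A (φ k) with z ∈ K, δ z (y (φ k))) /
      weight δ (y (φ k)) (A (φ k))) atTop (𝓝 (ν.real K)) := by
  simpa using h.tendsto_setIntegral hKc hK (continuousOn_const (c := (1 : ℝ)))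

/-- The vague limit of an averaging sequence transforms by `δ` along the generators. -/
lemma IsVagueLimit.hasDensityAlong [LocallyCompactSpace T]
    [SecondCountableTopology T] [IsFiniteMeasure ν]
    (hzero : TopologicalSpace.IsTopologicalBasis {U : Set T | IsClopen U})
    (h : IsVagueLimit δ y A φ ν) (hφ : StrictMono φ) (hA : IsAveragingSequence Γ S δ y A)
    (hδ : IsCocycle Γ δ) (hfree : ActsFreely Γ) (hδcont : IsContinuousCocycle Γ δ)
    (hS : ∀ γ ∈ S, γ ∈ Γ) {γ : OpenPartialHomeomorph T T} (hγS : γ ∈ S) :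
    HasDensityAlong δ ν γ := by
  classical
  have hγ := hS γ hγS
  have hρ := continuousOn_cocycle_apply hfree hδcont hγ
  have hmain : ∀ K ⊆ γ.source, IsCompact K → IsClopen K →
      ν.real (γ '' K) = ∫ x in K, δ (γ x) x ∂ν := by
    intro K hKs hKc hK
    have hγKc : IsCompact (γ '' K) := hKc.image_of_continuousOn (γ.continuousOn.mono hKs)
    have hγK : IsClopen (γ '' K) :=
      ⟨hγKc.isClosed, γ.isOpen_image_of_subset_source hK.2 hKs⟩
    obtain ⟨M, hM⟩ := hKc.exists_bound_of_continuousOn (hρ.mono hKs)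
    have hM' : ∀ x ∈ K, δ (γ x) x ≤ |M| := fun x hx =>
      (le_abs_self _).trans ((hM x hx).trans (le_abs_self M))
    have h1 := h.tendsto_measureReal hγKc hγK
    have h2 := h.tendsto_setIntegral hKc hK (hρ.mono hKs)
    have h3 := (((hA.tendsto γ hγS).comp hφ.tendsto_atTop).const_mul |M|)
    rw [mul_zero] at h3
    have h4 := squeeze_zero_norm (fun k => ?_) h3 (f := fun k =>
      (∑ z ∈ A (φ k) with z ∈ γ '' K, δ z (y (φ k))) / weight δ (y (φ k)) (A (φ k)) -
      (∑ z ∈ A (φ k) with z ∈ K, δ (γ z) z * δ z (y (φ k))) / weight δ (y (φ k)) (A (φ k)))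
    · exact sub_eq_zero.1 (tendsto_nhds_unique (h1.sub h2) h4)
    · have hW := hA.weight_pos hδ (φ k)
      rw [← sub_div, norm_div, Real.norm_eq_abs, Real.norm_eq_abs, abs_of_pos hW,
        Function.comp_apply, ← mul_div_assoc]
      exact div_le_div_of_nonneg_right (abs_sum_image_sub_sum_le hδ hγ
        (hA.subset_orbit (φ k)) hKs hM' (abs_nonneg M)) hW.le
  have hsm : AEMeasurable γ.symm (ν.restrict γ.target) :=
    aemeasurable_of_subset_source γ.symm γ.open_target.measurableSet subset_rfl
  have hμ₁ : ∀ B, MeasurableSet B → B ⊆ γ.source →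
      (ν.restrict γ.target).map γ.symm B = ν (γ '' B) := by
    intro B hB hBs
    rw [Measure.map_apply_of_aemeasurable hsm hB,
      Measure.restrict_apply' γ.open_target.measurableSet,
      γ.image_eq_target_inter_inv_preimage hBs, Set.inter_comm]
  have hμ₂ : ∀ B, B ⊆ γ.source →
      ((ν.restrict γ.source).withDensity fun x => ENNReal.ofReal (δ (γ x) x)) B =
        ∫⁻ x in B, ENNReal.ofReal (δ (γ x) x) ∂ν := by
    intro B hBs
    rw [withDensity_apply', Measure.restrict_restrict' γ.open_source.measurableSet,
      Set.inter_eq_left.2 hBs]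
  -- Both sides of the claim become measures concentrated on `γ.source`, so agreement on its compact
  -- open subsets is enough.
  have heq : (ν.restrict γ.target).map γ.symm =
      (ν.restrict γ.source).withDensity fun x => ENNReal.ofReal (δ (γ x) x) := by
    refine measure_eq_of_compactOpen hzero γ.open_source ?_ ?_ fun K hKs hKc hK => ?_
    · rw [Measure.map_apply_of_aemeasurable hsm γ.open_source.measurableSet.compl,
        Measure.restrict_apply' γ.open_target.measurableSet]
      convert measure_empty (μ := ν)
      ext z
      simp only [Set.mem_inter_iff, Set.mem_preimage, Set.mem_compl_iff, Set.mem_empty_iff_false,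
        iff_false, not_and]
      exact fun hz hz' => hz (γ.map_target hz')
    · refine withDensity_absolutelyContinuous _ _ ?_
      rw [Measure.restrict_apply' γ.open_source.measurableSet, Set.compl_inter_self,
        measure_empty]
    · rw [hμ₁ K hK.2.measurableSet hKs, hμ₂ K hKs, ← ofReal_integral_eq_lintegral_ofReal
        ((hρ.mono hKs).integrableOn_compact hKc) ?_, ← hmain K hKs hKc hK, ofReal_measureReal]
      refine (ae_restrict_iff' hK.2.measurableSet).2 (Eventually.of_forall fun x hx => ?_)
      exact (hδ.1 _ _ (orbitRel_symm (orbitRel_apply hγ (hKs hx)))).le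
  intro B hB hBs
  rw [← hμ₁ B hB hBs, heq, hμ₂ B hBs]

/-- Recurrence prevents the mass of an averaging sequence from escaping to infinity. -/
lemma IsVagueLimit.ne_zero [LocallyCompactSpace T]
    (hzero : TopologicalSpace.IsTopologicalBasis {U : Set T | IsClopen U})
    (h : IsVagueLimit δ y A φ ν) (hφ : StrictMono φ) (hA : IsAveragingSequence Γ S δ y A)
    (hδ : IsCocycle Γ δ) (hδharm : IsHarmonicCocycle Γ S δ) (hS : ∀ γ ∈ S, γ ∈ Γ)
    (hSfin : S.Finite) {T₁ : Set T} (hT₁ : IsCompact (closure T₁)) (hrec : IsRecurrent S T₁) :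
    ν ≠ 0 := by
  classical
  rintro rfl
  obtain ⟨m, e, he⟩ := exists_enumeratesEdges hS hSfin
  obtain ⟨N, hN⟩ := hrec
  obtain ⟨K, hKc, hK, hTK⟩ := exists_compactOpen_superset hzero hT₁
  have h1 := h.tendsto_measureReal hKc hK
  have h2 : Tendsto (fun k => ∑ γ ∈ hSfin.toFinset,
      weight δ (y (φ k)) (differenceSet γ (A (φ k)) ∩ γ.source) /
        weight δ (y (φ k)) (A (φ k))) atTop (𝓝 0) := by
    have := tendsto_finsetSum hSfin.toFinset fun γ hγ =>
      (hA.tendsto γ (by simpa using hγ)).comp hφ.tendsto_atTop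
    simpa using this
  have h3 := (h1.add h2).const_mul ((1 + (m : ℝ)) ^ N)
  -- Dividing the estimate of `EnumeratesEdges.weight_le` by `|A|` and passing to the limit would
  -- give `1 ≤ 0` if all mass escaped.
  have h4 : (1 : ℝ) ≤ (1 + (m : ℝ)) ^ N * ((0 : Measure T).real K + 0) := by
    refine ge_of_tendsto' h3 fun k => ?_
    have hW := hA.weight_pos hδ (φ k)
    rw [← Finset.sum_div, ← add_div, ← mul_div_assoc, one_le_div hW]
    refine (he.weight_le hδ hδharm hS hSfin hN (hA.subset_orbit (φ k))).trans ?_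
    gcongr
    · intro z hz _
      exact (hδ.1 _ _ (orbitRel_symm (hA.subset_orbit _ z (Finset.mem_filter.1 hz).1))).le
    · exact fun z hz => hTK (subset_closure hz)
  simp at h4
  linarith

lemma IsVagueLimit.mem_limitSet [LocallyCompactSpace T] [FirstCountableTopology T]
    [IsFiniteMeasure ν]
    (hzero : TopologicalSpace.IsTopologicalBasis {U : Set T | IsClopen U})
    (h : IsVagueLimit δ y A φ ν) (hφ : StrictMono φ) {x : T} (hx : ∀ U ∈ 𝓝 x, ν U ≠ 0) :
    x ∈ limitSet A := by
  classical
  obtain ⟨U, hU⟩ := (𝓝 x).exists_antitone_basis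
  have hev : ∀ n, ∃ᶠ k in atTop, ∃ u ∈ A (φ k), u ∈ U n := by
    intro n
    obtain ⟨K, hKc, hK, hxK, hKU⟩ := exists_compactOpen_nhds hzero (hU.1.mem_of_mem (i := n) trivial)
    have hpos : 0 < ν.real K :=
      ENNReal.toReal_pos (hx K (hK.2.mem_nhds hxK)) (measure_ne_top ν K)
    refine (((h.tendsto_measureReal hKc hK).eventually_const_lt hpos).mono fun k hk => ?_).frequently
    by_contra! hne
    have : (A (φ k)).filter (fun z => z ∈ K) = ∅ :=
      Finset.filter_eq_empty_iff.2 fun z hz hzK => hne z hz (hKU hzK)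
    rw [this] at hk
    simp at hk
  -- A diagonal extraction along a shrinking neighbourhood basis yields points of the sets `A (φ k)`
  -- converging to `x`.
  obtain ⟨ψ, hψ, hP⟩ := extraction_forall_of_frequently hev
  choose u huA huU using hP
  exact ⟨φ ∘ ψ, u, hφ.comp hψ, huA, hU.tendsto huU⟩

end Limit

end Averaging

/-! ### The harmonic measure of an averaging sequence -/

theorem corollary3p3 {T : Type*} [TopologicalSpace T] [TopologicalSpace.MetrizableSpace T]
    [TopologicalSpace.SeparableSpace T] [LocallyCompactSpace T]
    [MeasurableSpace T] [BorelSpace T]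
    (hzero : TopologicalSpace.IsTopologicalBasis {U : Set T | IsClopen U})
    (Γ : StructureGroupoid T) [ClosedUnderRestriction Γ]
    (hfree : Averaging.ActsFreely Γ)
    (T₁ : Set T) (E : Set (OpenPartialHomeomorph T T))
    (hE : Averaging.IsCompactGenerationSystem Γ T₁ E)
    (S : Set (OpenPartialHomeomorph T T)) (hSfin : S.Finite)
    (hSgen : Averaging.Generates Γ S) (hSrec : Averaging.IsRecurrent S T₁)
    (δ : T → T → ℝ) (hδ : Averaging.IsCocycle Γ δ)
    (hδcont : Averaging.IsContinuousCocycle Γ δ)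
    (hδharm : Averaging.IsHarmonicCocycle Γ S δ)
    (y : ℕ → T) (A : ℕ → Finset T)
    (hA : Averaging.IsAveragingSequence Γ S δ y A) :
    ∃ ν : Measure T, ν ≠ 0 ∧ IsFiniteMeasure ν ∧ ν.Regular ∧
      Averaging.IsHarmonicMeasure Γ S ν ∧
      ν.support ⊆ Averaging.limitSet A ∧
      ∃ (φ : ℕ → ℕ) (ν₀ : Measure T), StrictMono φ ∧ IsFiniteMeasure ν₀ ∧
        Averaging.IsVagueLimit δ y A φ ν₀ ∧
        Averaging.HasRadonNikodymCocycle Γ δ ν₀ ∧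
        ν = ν₀.withDensity fun x => (Averaging.deg S x : ENNReal) := by
  let : MetricSpace T := TopologicalSpace.metrizableSpaceMetric T
  have : SecondCountableTopology T := UniformSpace.secondCountable_of_separable T
  have hS := hSgen.1
  obtain ⟨m, e, he⟩ := Averaging.exists_enumeratesEdges hS hSfin
  obtain ⟨φ, ν₀, hφ, hfin, hlim⟩ := Averaging.exists_isVagueLimit hA hδ
  have hRN : Averaging.HasRadonNikodymCocycle Γ δ ν₀ :=
    Averaging.hasRadonNikodymCocycle_of_generates hSgen hδ hfree hδcont fun γ hγ =>
      hlim.hasDensityAlong hzero hφ hA hδ hfree hδcont hS hγ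
  have hne := hlim.ne_zero hzero hφ hA hδ hδharm hS hSfin hE.isCompact_closure hSrec
  have hfin' := he.isFiniteMeasure_withDensity_deg (ν := ν₀)
  refine ⟨ν₀.withDensity fun x => (Averaging.deg S x : ENNReal), ?_, hfin', inferInstance,
    he.isHarmonicMeasure_withDensity_deg hRN hδ hfree hδcont hδharm hS, ?_,
    φ, ν₀, hφ, hfin, hlim, hRN, rfl⟩
  · rwa [Ne, ← Measure.measure_univ_eq_zero, he.withDensity_deg_eq_zero_iff hδ hδharm,
      Measure.measure_univ_eq_zero]
  · intro x hx
    refine hlim.mem_limitSet hzero hφ fun U hU h0 => ?_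
    have := (Measure.mem_support_iff_forall x).1 hx U hU
    rw [(he.withDensity_deg_eq_zero_iff hδ hδharm U).2 h0] at this
    exact lt_irrefl _ this
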